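/- Let $\mathbb{F}_q$ be a finite field with $q$ elements, let $M\in\mathbb{F}_q^{n\times n}$ have minimal polynomial $\mu_M$, and let $0<\varepsilon<1/2$. Vectors are row vectors, $V=\mathbb{F}_q^n$. Consider the following algorithm MinPolyMC. (1) (CharPoly.) Choose vectors $v^{(1)},v^{(2)},\dots$ one after the other, where $v^{(i)}$ is uniformly distributed in $V\setminus W_{i-1}$ and $W_{i-1}$ is the smallest $M$-invariant subspace containing $v^{(1)},\dots,v^{(i-1)}$, until $W_k=V$. (The vector $v^{(i)}$ is obtained as the sum of a uniformly distributed element of $W_{i-1}$ and a uniformly distributed non-zero element of a complement of $W_{i-1}$.) By Gaussian elimination on the vectors $v^{(i)}M^j$ (kept in row semi echelon form) compute for each $i$ the relative order polynomial $p^{(i)}$, that is, the monic polynomial of least degree $d_i$ with $v^{(i)}p^{(i)}(M)\in W_{i-1}$. Let $Y$ be the matrix with rows $v^{(i)}M^j$, $1\le i\le k$, $0\le j<d_i$, and express $v^{(i)}M^{d_i}$ as $b^{(i)}Y$. Put $s_i=d_1+\dots+d_i$. (2) Factorise all $p^{(j)}$ by a given (possibly randomised, always correct) factorisation procedure. Let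 $q_1,\dots,q_t$ be the distinct monic irreducible factors that occur; they are the monic irreducible factors of the characteristic polynomial of $M$. (3) Let $u_0\ge 0$ be the least integer with $\sum_{r=1}^t q^{-u_0\deg q_r}\le\varepsilon$, and $u=\min\{u_0,k\}$. (4) Let $f$ be the least common multiple of $p^{(1)},\dots,p^{(k)}$ and of the order polynomials $\mathrm{ord}_M(v^{(i)})$, $2\le i\le u$ (the monic polynomial $g$ of least degree with $v^{(i)}g(M)=0$). These are computed in factorised form with respect to the sparse matrix $YMY^{-1}$: for $j=i,i-1,\dots,1$ let $h$ be the polynomial whose coefficients are the entries of the current vector in the positions $s_{j-1}+1,\dots,s_j$; if $h\ne0$, record $g=p^{(j)}/\gcd(h,p^{(j)})$ and, if $j>1$, replace the current vector by its image under $g(YMY^{-1})$; the start vector is the standard basis vector with index $s_{i-1}+1$. (5) Return $(\text{True},f)$ if $u=k$ or $\deg f=n$, and $(\text{Uncertain},f)$ otherwise; $f$ is returned in factorised form. The elementary field operations are additions, subtractions, multiplications and divisions of two elements of $\mathbb{F}_q$. Let $\mathrm{char}(n,q)$ be an upper bound for the number of elementary field operations of step (1) for $n\times n$ matrices over $\mathbb{F}_q$,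 and let $\mathrm{fact}(n,q)$ be an upper bound for the number of elementary field operations needed by the factorisation procedure for all members of a sequence of monic non-constant polynomials over $\mathbb{F}_q$ whose degrees sum to $n$. Let $\xi_r$ be an upper bound for the cost of drawing a random vector from an $r$-dimensional space, where $\xi$ is non-negative, non-decreasing and $\xi_a+\xi_b\le\xi_{a+b}$. Then: (a) With probability at least $1-\varepsilon$ the returned polynomial is $f=\mu_M$. (b) In every run: if True is returned, then $f=\mu_M$. In any case $f$ is monic and divides $\mu_M$, and every irreducible factor of $\mu_M$ divides $f$; if $f\neq\mu_M$, then $f$ is a proper divisor of $\mu_M$. Moreover either $u=k$, or $u<k$ and $\sum_{j=1}^t q^{-u\deg q_j}\le\varepsilon$. (c) In every run the number of elementary field operations is at most $$\mathrm{char}(n,q)+\mathrm{fact}(n,q)+\sum_{i=1}^u\Bigl(\frac i2+9\Bigr)s_i^2,$$ and the additional cost of drawing random vectors in step (1) is at most $k\,\xi_n\le n\,\xi_n$, with $k\le n$. (d) For fixed $\varepsilon$ there is $N$ (depending only on $\varepsilon$) such that for all $q$ and all $n\ge N$, with a suitable bound $\mathrm{char}(n,q)$, the bound in (c) is in every run less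 than $$6n^3+\mathrm{fact}(n,q)+\frac13\left\lceil\frac{\log_2 n-\log_2\varepsilon}{\log_2 q}\right\rceil^2 n^2,$$ which is less than $7n^3+\mathrm{fact}(n,q)$. -/

import Mathlib

open Polynomial

universe u

noncomputable section

/-! ### Counting elementary field operations -/

/-- A value together with the number of elementary field operations spent on computing it.
Copying, indexing, comparing and integer arithmetic are free. -/
structure Counted (α : Type u) where
  val : α
  cost : ℕ

namespace Counted

instance : Monad Counted where
  pure a := ⟨a, 0⟩
  bind x f := ⟨(f x.val).val, x.cost + (f x.val).cost⟩

variable {K : Type u} [Field K]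

/-! The four elementary field operations. -/

def add (x y : K) : Counted K := ⟨x + y, 1⟩
def sub (x y : K) : Counted K := ⟨x - y, 1⟩
def mul (x y : K) : Counted K := ⟨x * y, 1⟩
def div (x y : K) : Counted K := ⟨x / y, 1⟩

/-- Compute all coordinates of a vector of length `n`. -/
def vec {n : ℕ} (f : Fin n → Counted K) : Counted (Fin n → K) :=
  ⟨fun j => (f j).val, ∑ j, (f j).cost⟩

/-- Compute the entries `0, …, m - 1` of an array (the other entries are `0`). -/
def arr (m : ℕ) (f : ℕ → Counted K) : Counted (ℕ → K) :=
  ⟨fun j => if j < m then (f j).val else 0, ∑ j ∈ Finset.range m, (f j).cost⟩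

/-- Compute the coefficients of `x ^ 0, …, x ^ (m - 1)` of a polynomial of degree `< m`. -/
def poly (m : ℕ) (f : ℕ → Counted K) : Counted K[X] :=
  ⟨∑ j ∈ Finset.range m, monomial j (f j).val, ∑ j ∈ Finset.range m, (f j).cost⟩

/-- Add the computed summands `g i`, for `i` in a list, to an initial value. -/
def accumulate {ι : Type} (init : K) : List ι → (ι → Counted K) → Counted K
  | [], _ => pure init
  | i :: is, g => do
      let t ← g i
      let s ← add init t
      accumulate s is g

/-- The row vector `v` times the matrix `M`. -/
def vecMul {n : ℕ} (v : Fin n → K) (M : Matrix (Fin n) (Fin n) K) : Counted (Fin n → K) :=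
  vec fun j => accumulate 0 (List.finRange n) fun i => mul (v i) (M i j)

/-- The row vector `(a 0, …, a (m - 1))` times the lower triangular `m × m` matrix `T`. -/
def mulTriangular (m : ℕ) (a : ℕ → K) (T : ℕ → ℕ → K) : Counted (ℕ → K) :=
  arr m fun j => accumulate 0 (List.range' j (m - j)) fun i => mul (a i) (T i j)

end Counted

open Counted

/-! ### Semi echelon data sequences and relative order polynomials -/

/-- The data `(Y, S, T, l)` of a semi echelon data sequence for vectors of length `n`; only the
rows with index `< len` are meaningful. Row and column indices start with `0`. -/
structure SemiEchelon (K : Type u) (n : ℕ) where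
  len : ℕ
  Y : ℕ → Fin n → K
  S : ℕ → Fin n → K
  T : ℕ → ℕ → K
  l : ℕ → ℕ

variable {K : Type u} [Field K] {n : ℕ}

/-- The trivial sequence. -/
def SemiEchelon.trivial (K : Type u) [Field K] (n : ℕ) : SemiEchelon K n where
  len := 0
  Y := 0
  S := 0
  T := 0
  l := 0

/-- The entry of `w` in column `c`. -/
def coord (w : Fin n → K) (c : ℕ) : K := if h : c < n then w ⟨c, h⟩ else 0

/-- The `for` loop of CleanAndExtend, after `i` rounds: the coefficients `a` and the vector
`w = v - a S`. -/
def cleanLoop (E : SemiEchelon K n) (v : Fin n → K) : ℕ → Counted ((ℕ → K) × (Fin n → K))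
  | 0 => pure (0, v)
  | i + 1 => do
      let r ← cleanLoop E v i
      let c := coord r.2 (E.l i)
      let w ← vec fun j => do
        let t ← mul c (E.S i j)
        sub (r.2 j) t
      pure (Function.update r.1 i c, w)

open Classical in
/-- CleanAndExtend: `(true, E, a)` if `v` is in the row space of `E`, and `(false, E', a')` with
`E'` extending `E` by the vector `v` otherwise. -/
def cleanAndExtend (E : SemiEchelon K n) (v : Fin n → K) :
    Counted (Bool × SemiEchelon K n × (ℕ → K)) := do
  let r ← cleanLoop E v E.len
  let a := r.1
  let w := r.2
  if h : (Finset.univ.filter fun j => w j ≠ 0).Nonempty then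
    -- the index of the first non-zero entry
    let j : Fin n := (Finset.univ.filter fun j => w j ≠ 0).min' h
    let c ← div 1 (w j)
    let s ← vec fun i => mul c (w i)
    let aT ← mulTriangular E.len a E.T
    let c' ← sub 0 c
    let t ← arr E.len fun i => mul c' (aT i)
    pure (false,
      { len := E.len + 1
        Y := Function.update E.Y E.len v
        S := Function.update E.S E.len s
        T := Function.update E.T E.len (Function.update t E.len c)
        l := Function.update E.l E.len j },
      Function.update a E.len (w j))
  else
    pure (true, E, a)

/-- The loop of RelativeOrdPoly: extend by `v, v M, v M ^ 2, …` until the vector is in the row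
space. The first argument bounds the number of rounds; `n + 1` rounds always suffice, because
each round but the last one increases the length. -/
def relLoop (M : Matrix (Fin n) (Fin n) K) :
    ℕ → SemiEchelon K n → (Fin n → K) → Counted (SemiEchelon K n × (ℕ → K))
  | 0, E, _ => pure (E, 0)
  | r + 1, E, v => do
      let x ← cleanAndExtend E v
      if x.1 then
        pure x.2
      else
        let v' ← vecMul v M
        relLoop M r x.2.1 v'

/-- RelativeOrdPoly: the relative order polynomial `p` of `v`, of degree `d`, the extended
data sequence, and the vector `b` with `v M ^ d = b Y'`. -/
def relativeOrdPoly (E : SemiEchelon K n) (v : Fin n → K) (M : Matrix (Fin n) (Fin n) K) :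
    Counted (K[X] × SemiEchelon K n × (ℕ → K)) := do
  let x ← relLoop M (n + 1) E v
  let d := x.1.len - E.len
  let b ← mulTriangular x.1.len x.2 x.1.T
  let p ← Counted.poly d fun i => sub 0 (b (E.len + i))
  pure (X ^ d + p, x.1, b)

/-! ### Randomised programs -/

/-- What a run of a randomised program has consumed: the number of elementary field operations,
and the dimensions of the spaces from which random vectors have been drawn. -/
structure Tally where
  ops : ℕ
  draws : List ℕ

/-- A randomised program: the joint law of its result and its consumption. -/
structure Prog (α : Type u) where
  law : PMF (α × Tally)

namespace Prog

instance : Monad Prog where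
  pure a := ⟨PMF.pure (a, ⟨0, []⟩)⟩
  bind x f := ⟨x.law.bind fun r => (f r.1).law.bind fun t =>
    PMF.pure (t.1, ⟨r.2.ops + t.2.ops, r.2.draws ++ t.2.draws⟩)⟩

/-- A deterministic computation as a program. -/
def det {α : Type u} (x : Counted α) : Prog α := ⟨PMF.pure (x.val, ⟨x.cost, []⟩)⟩

/-- RandomVector for the space of all vectors of length `m`. -/
def randomVector (K : Type u) [Field K] [Fintype K] (m : ℕ) : Prog (ℕ → K) :=
  ⟨(PMF.uniformOfFintype (Fin m → K)).map fun a => (coord a, ⟨0, [m]⟩)⟩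

open Classical in
/-- RandomVector* for the space `V(l)` of all vectors that vanish in the leading columns of `E`,
which has dimension `n - E.len`: a uniformly distributed non-zero element. -/
def randomVectorNeZero [Fintype K] (E : SemiEchelon K n) : Prog (Fin n → K) :=
  let A : Finset (Fin n → K) :=
    Finset.univ.filter fun v => v ≠ 0 ∧ ∀ i < E.len, coord v (E.l i) = 0
  ⟨if h : A.Nonempty then (PMF.uniformOfFinset A h).map fun v => (v, ⟨0, [n - E.len]⟩)
    else PMF.pure (0, ⟨0, [n - E.len]⟩)⟩

end Prog

/-! ### The characteristic polynomial -/

/-- The output of CharPoly: the number `k` of rounds, the semi echelon data sequence, and, for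
`j < k`, the relative order polynomial `p j` and the vector `b j` (padded with zeros) that
RelativeOrdPoly returned in round `j`, where the first round has the number `0`. -/
structure CharData (K : Type u) [Field K] (n : ℕ) where
  k : ℕ
  p : ℕ → K[X]
  E : SemiEchelon K n
  b : ℕ → ℕ → K

/-- `s i` is the sum of the degrees of the first `i` relative order polynomials. -/
def CharData.s (D : CharData K n) (i : ℕ) : ℕ := ∑ j ∈ Finset.range i, (D.p j).natDegree

/-- The `while` loop of CharPoly. The first argument bounds the number of rounds; `n` rounds
always suffice, because each round increases the length. -/
def charLoop [Fintype K] (M : Matrix (Fin n) (Fin n) K) :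
    ℕ → CharData K n → Prog (CharData K n)
  | 0, D => pure D
  | r + 1, D =>
      if D.E.len < n then do
        let a ← Prog.randomVector K D.E.len
        let c ← Prog.randomVectorNeZero D.E
        let v ← Prog.det (vec fun j =>
          accumulate (c j) (List.range D.E.len) fun i => mul (a i) (D.E.S i j))
        let x ← Prog.det (relativeOrdPoly D.E v M)
        charLoop M r
          { k := D.k + 1
            p := Function.update D.p D.k x.1
            E := x.2.1
            b := Function.update D.b D.k x.2.2 }
      else
        pure D

/-- CharPoly. -/
def charPoly [Fintype K] (M : Matrix (Fin n) (Fin n) K) : Prog (CharData K n) :=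
  charLoop M n { k := 0, p := 0, E := SemiEchelon.trivial K n, b := 0 }

/-! ### Factorisation -/

/-- A (possibly randomised) procedure that factorises monic polynomials: the joint law of the list
of monic irreducible factors, with multiplicities, and of the number of operations. -/
structure Factoriser (K : Type u) [Field K] where
  law : K[X] → PMF (List K[X] × ℕ)
  correct : ∀ p : K[X], p.Monic → ∀ r ∈ (law p).support,
    (∀ g ∈ r.1, g.Monic ∧ Irreducible g) ∧ r.1.prod = p

/-- Factorise the polynomials `p 0, …, p (k - 1)`. -/
def factoriseAll (F : Factoriser K) (p : ℕ → K[X]) : ℕ → Prog (ℕ → List K[X])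
  | 0 => pure fun _ => []
  | k + 1 => do
      let L ← factoriseAll F p k
      let g ← Prog.mk ((F.law (p k)).map fun r => (r.1, ⟨r.2, []⟩))
      pure (Function.update L k g)

/-! ### Absolute order polynomials -/

/-- Long division of `h`, of degree `< q.natDegree + r`, by a monic polynomial `q`:
quotient and remainder. -/
def divMod (q : K[X]) : ℕ → K[X] → Counted (K[X] × K[X])
  | 0, h => pure (0, h)
  | i + 1, h => do
      let c := h.coeff (q.natDegree + i)
      let h' ← Counted.poly (q.natDegree + i) fun j =>
        if i ≤ j then do
          let t ← mul c (q.coeff (j - i))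
          sub (h.coeff j) t
        else
          pure (h.coeff j)
      let x ← divMod q i h'
      -- the coefficient of `x ^ i` in the quotient is stored
      pure (x.1 + monomial i c, x.2)

open Classical in
/-- The list of irreducible factors of `q ^ e / gcd (h, q ^ e)`, for `q` monic irreducible and
`h ≠ 0`, by repeated division of `h` by `q`. -/
def cofactor (q : K[X]) : ℕ → K[X] → Counted (List K[X])
  | 0, _ => pure []
  | e + 1, h =>
      if h.natDegree < q.natDegree then
        pure (List.replicate (e + 1) q)
      else do
        let x ← divMod q (h.natDegree - q.natDegree + 1) h
        if x.2 = 0 then cofactor q e x.1 else pure (List.replicate (e + 1) q)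

open Classical in
/-- The list of irreducible factors of `p / gcd (h, p)`, where `L` lists the irreducible factors
of `p`; the list argument runs through the distinct irreducible factors. -/
def cofactors (L : List K[X]) (h : K[X]) : List K[X] → Counted (List K[X])
  | [] => pure []
  | q :: qs => do
      let x ← cofactor q (L.count q) h
      let y ← cofactors L h qs
      pure (x ++ y)

open Classical in
/-- A vector `w`, with zero entries from position `D.s z` on, times the matrix `Y M Y⁻¹`: a shift
inside the blocks, and multiples of the rows `b j` for `j < z`, of which only the first
`D.s (j + 1)` entries can be non-zero. -/
def mulSparse (D : CharData K n) (z : ℕ) (w : ℕ → K) : Counted (ℕ → K) :=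
  arr (D.s z) fun c =>
    accumulate (if ∃ j < z, c = D.s j then 0 else w (c - 1))
      ((List.range z).filter fun j => c < D.s (j + 1))
      fun j => mul (w (D.s (j + 1) - 1)) (D.b j c)

/-- After `r` rounds: `v M' ^ r` and the sum of the `g.coeff i • v M' ^ i` for `i ≤ r`, where
`M' = Y M Y⁻¹`. -/
def applyLoop (D : CharData K n) (z : ℕ) (g : K[X]) (v : ℕ → K) :
    ℕ → Counted ((ℕ → K) × (ℕ → K))
  | 0 => do
      let y ← arr (D.s z) fun c => mul (g.coeff 0) (v c)
      pure (v, y)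
  | r + 1 => do
      let x ← applyLoop D z g v r
      let w ← mulSparse D z x.1
      let y ← arr (D.s z) fun c => do
        let t ← mul (g.coeff (r + 1)) (w c)
        add (x.2 c) t
      pure (w, y)

/-- `v g(Y M Y⁻¹)` for the product `g` of a list of polynomials, one factor after the other. -/
def applyFactors (D : CharData K n) (z : ℕ) : List K[X] → (ℕ → K) → Counted (ℕ → K)
  | [], v => pure v
  | g :: gs, v => do
      let x ← applyLoop D z g v g.natDegree
      applyFactors D z gs x.2

open Classical in
/-- OrdPoly: a list of polynomials with product the order polynomial, with respect to
`Y M Y⁻¹`, of the vector `v`, which has zero entries from position `D.s i` on. The list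
`L j` is the factorisation of `D.p j`. -/
def ordPoly (D : CharData K n) (L : ℕ → List K[X]) : ℕ → (ℕ → K) → Counted (List K[X])
  | 0, _ => pure []
  | i + 1, v =>
      let h : K[X] := ∑ j ∈ Finset.range (D.p i).natDegree, monomial j (v (D.s i + j))
      if h ≠ 0 then do
        let g ← cofactors (L i) h (L i).dedup
        let v' ← if 0 < i then applyFactors D (i + 1) g v else pure v
        let f ← ordPoly D L i v'
        pure (g ++ f)
      else
        ordPoly D L i v

/-! ### The minimal polynomial -/

inductive Verdict where
  | certain
  | uncertain

/-- The output of MinPolyMC, where the polynomial is returned in factorised form, together with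
the values of the variables `k`, `u` and `s` of the run. -/
structure MinPolyResult (K : Type u) [Field K] where
  verdict : Verdict
  factors : Multiset K[X]
  k : ℕ
  u : ℕ
  s : ℕ → ℕ

/-- The polynomial that is returned. -/
def MinPolyResult.f (r : MinPolyResult K) : K[X] := r.factors.prod

open Classical in
/-- The `for` loop of MinPolyMC, over a list of values of `i`. The least common multiple of
factorised polynomials is the union of the multisets of irreducible factors. -/
def lcmLoop (D : CharData K n) (L : ℕ → List K[X]) :
    List ℕ → Multiset K[X] → Counted (Multiset K[X])
  | [], f => pure f
  | i :: is, f => do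
      let g ← ordPoly D L i (Pi.single (D.s (i - 1)) 1)
      lcmLoop D L is (f ∪ (g : Multiset K[X]))

open Classical in
/-- MinPolyMC, with a given procedure for the factorisation step. -/
def minPolyMC [Fintype K] (F : Factoriser K) (M : Matrix (Fin n) (Fin n) K) (ε : ℝ) :
    Prog (MinPolyResult K) := do
  let D ← charPoly M
  let L ← factoriseAll F D.p D.k
  let Q : Finset K[X] := (Finset.range D.k).biUnion fun j => (L j).toFinset
  let u₀ : ℕ := sInf {u : ℕ | ∑ g ∈ Q, ((Fintype.card K : ℝ) ^ (u * g.natDegree))⁻¹ ≤ ε}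
  let u : ℕ := min u₀ D.k
  let f₀ : Multiset K[X] := (Finset.range D.k).sup fun j => (L j : Multiset K[X])
  -- the values `i = 2, …, u`
  let f ← Prog.det (lcmLoop D L (List.range' 2 (u - 1)) f₀)
  pure
    { verdict := if u = D.k ∨ (f.map natDegree).sum = n then .certain else .uncertain
      factors := f
      k := D.k
      u := u
      s := D.s }

open Classical in
/-- The set of monic irreducible factors of a polynomial. -/
def irreducibleFactors (p : K[X]) : Finset K[X] :=
  (UniqueFactorizationMonoid.normalizedFactors p).toFinset

/-! ### Bounds for the subprograms -/

/-- `B` is an upper bound `char(n, q)` for the number of elementary field operations in CharPoly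
for `n × n` matrices over `K`. -/
def IsCharBound (K : Type u) [Field K] [Fintype K] (n B : ℕ) : Prop :=
  ∀ M : Matrix (Fin n) (Fin n) K, ∀ r ∈ (charPoly M).law.support, r.2.ops ≤ B

/-- `B` is an upper bound `fact(n, q)` for the number of elementary field operations that `F` needs
to factorise all members of a sequence of polynomials over `K` whose degrees sum to `n`. -/
def IsFactBound (F : Factoriser K) (n B : ℕ) : Prop :=
  ∀ (k : ℕ) (p : ℕ → K[X]), (∀ j < k, (p j).Monic ∧ 0 < (p j).natDegree) →
    ∑ j ∈ Finset.range k, (p j).natDegree = n →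
    ∀ r ∈ (factoriseAll F p k).law.support, r.2.ops ≤ B

/-- The assumptions on an upper bound `ξ r` for the cost of drawing a random vector from an
`r`-dimensional space. -/
def IsDrawCost (ξ : ℕ → ℝ) : Prop :=
  (∀ r, 0 ≤ ξ r) ∧ Monotone ξ ∧ ∀ r₁ r₂, ξ r₁ + ξ r₂ ≤ ξ (r₁ + r₂)

end

/-!
The vectors `v` chosen by CharPoly, with the relative order polynomials `p 0, …, p (k - 1)`, give a
basis `Y` of the space of row vectors, consisting of the vectors `v i * M ^ c` with
`c < deg (p i)`, and a flag of `M`-invariant subspaces, the spans of the first `s i` rows of `Y`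
(`CharData.Valid`, `charPoly_spec`). A polynomial maps `v i` into the `i`-th subspace if and only if `p i` divides it
(`CharData.Valid.rowAct_mem_iff`). Hence every `p i` divides the minimal polynomial `μ`, while `μ`
divides the product of all `p i`, so that the `p i` have the same irreducible factors as `μ`, and
thus as the characteristic polynomial.

OrdPoly descends along this flag. If `h` is the part of the current vector in the topmost block,
then a polynomial `f` maps the vector into the next smaller subspace if and only if `p` divides
`f * h`, that is, if and only if `p / gcd(h, p)` divides `f`; so the recorded factors multiply to
the order polynomial (`CharData.Valid.ordPoly_spec`). The result `f` is therefore a divisor of `μ`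
with the same irreducible factors, and it annihilates the first `u` vectors. If `u = k`, these
vectors generate the whole space, and `f = μ`; if `deg f = n`, then `f` is the characteristic
polynomial, and again `f = μ`.

If `f ≠ μ`, then `f` divides `μ / q` for some irreducible factor `q`, so that the first `u = u₀`
vectors all lie in the proper subspace `ker (μ / q)(M)`. Its codimension is at least `deg q`
(`natDegree_le_finrank_quotient`). Each `v i` is uniformly distributed outside of a subspace `W`, and
then lies in a given `U` with probability `(|U| - |U ∩ W|) / (|V| - |W|) ≤ |U| / |V|`
(`vectorLaw_le`). Thus the failure probability is at most the sum of `|K| ^ (-u₀ * deg q)` over all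
`q`, which is at most `ε` by the choice of `u₀` (`minPolyMC_failure_le`).

For the costs, a product of a vector with the sparse matrix `Y M Y⁻¹` on the first `s z` coordinates
needs `2 * (s 1 + ⋯ + s z)` operations, and the block with the last of these coordinates needs at
most as many such products as it has rows. Summation by parts bounds the cost of an order polynomial
by `(i / 2 + 7) * s i ^ 2` (`CharData.ordCost_le`). CharPoly needs at most `17 / 3 * n ^ 3 + O(n ^ 2)` operations
(`sum_roundCost_le`). Since `u₀` is at most the ceiling of `log_q (n / ε)`, which is `o(√n)`
uniformly in `q`, the remaining `n ^ 3 / 3` absorbs the terms of order `n ^ 2` for large `n`.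
-/

section

open scoped ENNReal

variable {K : Type u} [Field K] {n : ℕ}

/-! ### Values and costs of counted computations -/

namespace Counted

@[simp] theorem val_pure {α : Type u} (a : α) : (pure a : Counted α).val = a := rfl
@[simp] theorem cost_pure {α : Type u} (a : α) : (pure a : Counted α).cost = 0 := rfl
@[simp] theorem val_bind {α β : Type u} (x : Counted α) (f : α → Counted β) :
    (x >>= f).val = (f x.val).val := rfl
@[simp] theorem cost_bind {α β : Type u} (x : Counted α) (f : α → Counted β) :
    (x >>= f).cost = x.cost + (f x.val).cost := rfl
@[simp] theorem val_ite {α : Type u} (c : Prop) [Decidable c] (x y : Counted α) :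
    (if c then x else y).val = if c then x.val else y.val := apply_ite _ _ _ _
@[simp] theorem cost_ite {α : Type u} (c : Prop) [Decidable c] (x y : Counted α) :
    (if c then x else y).cost = if c then x.cost else y.cost := apply_ite _ _ _ _
@[simp] theorem val_add (x y : K) : (add x y).val = x + y := rfl
@[simp] theorem cost_add (x y : K) : (add x y).cost = 1 := rfl
@[simp] theorem val_sub (x y : K) : (sub x y).val = x - y := rfl
@[simp] theorem cost_sub (x y : K) : (sub x y).cost = 1 := rfl
@[simp] theorem val_mul (x y : K) : (mul x y).val = x * y := rfl
@[simp] theorem cost_mul (x y : K) : (mul x y).cost = 1 := rfl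
@[simp] theorem val_div (x y : K) : (div x y).val = x / y := rfl
@[simp] theorem cost_div (x y : K) : (div x y).cost = 1 := rfl
omit [Field K] in
@[simp] theorem val_vec (f : Fin n → Counted K) : (vec f).val = fun j => (f j).val := rfl
omit [Field K] in
@[simp] theorem cost_vec (f : Fin n → Counted K) : (vec f).cost = ∑ j, (f j).cost := rfl
@[simp] theorem val_arr (m : ℕ) (f : ℕ → Counted K) :
    (arr m f).val = fun j => if j < m then (f j).val else 0 := rfl
@[simp] theorem cost_arr (m : ℕ) (f : ℕ → Counted K) :
    (arr m f).cost = ∑ j ∈ Finset.range m, (f j).cost := rfl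
@[simp] theorem cost_poly (m : ℕ) (f : ℕ → Counted K) :
    (poly m f).cost = ∑ j ∈ Finset.range m, (f j).cost := rfl

theorem coeff_poly (m : ℕ) (f : ℕ → Counted K) (j : ℕ) :
    (poly m f).val.coeff j = if j < m then (f j).val else 0 := by
  simp [poly, coeff_monomial]

@[simp] theorem val_accumulate {ι : Type} (init : K) (l : List ι) (g : ι → Counted K) :
    (accumulate init l g).val = init + (l.map fun i => (g i).val).sum := by
  induction l generalizing init with
  | nil => simp [accumulate]
  | cons i is ih => simp [accumulate, ih, add_assoc]

@[simp] theorem cost_accumulate {ι : Type} (init : K) (l : List ι) (g : ι → Counted K) :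
    (accumulate init l g).cost = (l.map fun i => (g i).cost + 1).sum := by
  induction l generalizing init with
  | nil => simp [accumulate]
  | cons i is ih => simp [accumulate, ih, add_assoc]

theorem val_vecMul (v : Fin n → K) (M : Matrix (Fin n) (Fin n) K) :
    (vecMul v M).val = Matrix.vecMul v M := by
  funext j
  simp [vecMul, Matrix.vecMul, dotProduct, ← List.ofFn_eq_map, List.sum_ofFn]

theorem cost_vecMul (v : Fin n → K) (M : Matrix (Fin n) (Fin n) K) :
    (vecMul v M).cost = 2 * n ^ 2 := by
  simp [vecMul]; ring

theorem val_mulTriangular (m : ℕ) (a : ℕ → K) (T : ℕ → ℕ → K) (j : ℕ) :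
    (mulTriangular m a T).val j = if j < m then ∑ i ∈ Finset.Ico j m, a i * T i j else 0 := by
  simp only [mulTriangular, val_arr, val_accumulate, val_mul, zero_add]
  rfl

/-- Entry `j` takes `m - j` multiplications and as many additions. -/
theorem cost_mulTriangular (m : ℕ) (a : ℕ → K) (T : ℕ → ℕ → K) :
    (mulTriangular m a T).cost = m * (m + 1) := by
  have h := Finset.sum_range_reflect (fun j => (j + 1) * 2) m
  have h' : ∑ j ∈ Finset.range m, (j + 1) * 2 = m * (m + 1) := by
    rw [← Finset.sum_mul, Finset.sum_add_distrib, add_mul, Finset.sum_range_id_mul_two]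
    cases m <;> simp; ring
  rw [← h', ← h]
  simp only [mulTriangular, cost_arr, cost_accumulate, cost_mul]
  refine Finset.sum_congr rfl fun j hj => ?_
  have := Finset.mem_range.1 hj
  simp
  omega

end Counted

/-! ### Semi echelon data sequences -/

/-- The linear combination of the first `m` vectors of a sequence `Y` with coefficients `a`. -/
def comb (Y : ℕ → Fin n → K) (m : ℕ) (a : ℕ → K) : Fin n → K :=
  ∑ j ∈ Finset.range m, a j • Y j

/-- The span of the first `m` vectors of a sequence `Y`. -/
def rowSpan (Y : ℕ → Fin n → K) (m : ℕ) : Submodule K (Fin n → K) :=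
  Submodule.span K (Y '' Finset.range m)

theorem mem_rowSpan {Y : ℕ → Fin n → K} {m : ℕ} {v : Fin n → K} :
    v ∈ rowSpan Y m ↔ ∃ a, comb Y m a = v := by
  constructor
  · intro h
    obtain ⟨c, rfl⟩ := (Submodule.mem_span_image_finset_iff_exists_fun K).1 h
    refine ⟨fun j => if h : j ∈ Finset.range m then c ⟨j, h⟩ else 0, ?_⟩
    rw [comb, ← Finset.sum_coe_sort]
    exact Finset.sum_congr rfl fun j _ => by rw [dif_pos j.2]
  · rintro ⟨a, rfl⟩
    exact Submodule.sum_mem _ fun j hj =>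
      Submodule.smul_mem _ _ (Submodule.subset_span ⟨j, hj, rfl⟩)

theorem comb_mem_rowSpan (Y : ℕ → Fin n → K) (m : ℕ) (a : ℕ → K) : comb Y m a ∈ rowSpan Y m :=
  mem_rowSpan.2 ⟨a, rfl⟩

theorem mem_rowSpan_of_lt (Y : ℕ → Fin n → K) {m j : ℕ} (h : j < m) : Y j ∈ rowSpan Y m :=
  Submodule.subset_span ⟨j, by simpa using h, rfl⟩

theorem rowSpan_le {Y : ℕ → Fin n → K} {m : ℕ} {U : Submodule K (Fin n → K)} :
    rowSpan Y m ≤ U ↔ ∀ j < m, Y j ∈ U := by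
  simp [rowSpan, Submodule.span_le, Set.subset_def]

theorem rowSpan_mono (Y : ℕ → Fin n → K) {m m' : ℕ} (h : m ≤ m') : rowSpan Y m ≤ rowSpan Y m' :=
  rowSpan_le.2 fun _ hj => mem_rowSpan_of_lt Y (hj.trans_le h)

theorem comb_congr {Y Y' : ℕ → Fin n → K} {m : ℕ} {a a' : ℕ → K} (hY : ∀ j < m, Y j = Y' j)
    (ha : ∀ j < m, a j = a' j) : comb Y m a = comb Y' m a' :=
  Finset.sum_congr rfl fun j hj => by
    rw [hY j (Finset.mem_range.1 hj), ha j (Finset.mem_range.1 hj)]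

theorem rowSpan_congr {Y Y' : ℕ → Fin n → K} {m : ℕ} (h : ∀ j < m, Y j = Y' j) :
    rowSpan Y m = rowSpan Y' m := by
  ext v
  simp only [mem_rowSpan, comb_congr h fun _ _ => rfl]

theorem comb_add (Y : ℕ → Fin n → K) (m d : ℕ) (a : ℕ → K) :
    comb Y (m + d) a = comb Y m a + comb (fun j => Y (m + j)) d fun j => a (m + j) :=
  Finset.sum_range_add ..

/-- `coord` in a fixed column as a linear form. -/
def coordForm (K : Type u) [Field K] (n c : ℕ) : (Fin n → K) →ₗ[K] K where
  toFun w := coord w c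
  map_add' v w := by unfold coord; split <;> simp
  map_smul' a w := by unfold coord; split <;> simp

theorem coord_comb (Y : ℕ → Fin n → K) (m : ℕ) (a : ℕ → K) (c : ℕ) :
    coord (comb Y m a) c = ∑ j ∈ Finset.range m, a j * coord (Y j) c := by
  change coordForm K n c _ = _
  simp only [comb, map_sum, map_smul]
  rfl

theorem linearIndepOn_update {Y : ℕ → Fin n → K} {m : ℕ} {v : Fin n → K}
    (h : LinearIndepOn K Y (Finset.range m : Set ℕ)) (hv : v ∉ rowSpan Y m) :
    LinearIndepOn K (Function.update Y m v) (Finset.range (m + 1) : Set ℕ) := by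
  have hc : ∀ j < m, Y j = Function.update Y m v j := fun j hj =>
    (Function.update_of_ne hj.ne _ _).symm
  rw [Finset.range_add_one, Finset.coe_insert, linearIndepOn_insert (by simp),
    Function.update_self]
  exact ⟨h.congr fun j hj => hc j (by simpa using hj), by rwa [rowSpan_congr hc] at hv⟩

namespace SemiEchelon

/-- The invariants of a semi echelon data sequence: the row `S i` has the entry `1` in its leading
column `l i` and zeros in the earlier leading columns, `S = T Y` with `T` lower triangular, and the
rows of `Y` are linearly independent and lie in the row space of `S`. -/
structure Valid (E : SemiEchelon K n) : Prop where
  pivot : ∀ i < E.len, coord (E.S i) (E.l i) = 1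
  cleared : ∀ i < E.len, ∀ j < i, coord (E.S i) (E.l j) = 0
  S_eq : ∀ i < E.len, E.S i = comb E.Y (i + 1) (E.T i)
  indep : LinearIndepOn K E.Y (Finset.range E.len : Set ℕ)
  Y_mem : ∀ i < E.len, E.Y i ∈ rowSpan E.S E.len

theorem valid_trivial : (SemiEchelon.trivial K n).Valid := by
  constructor <;> simp [SemiEchelon.trivial]

namespace Valid
variable {E : SemiEchelon K n} (hE : E.Valid)
include hE

theorem rowSpan_S : rowSpan E.S E.len = rowSpan E.Y E.len := by
  refine le_antisymm (rowSpan_le.2 fun j hj => ?_) (rowSpan_le.2 hE.Y_mem)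
  rw [hE.S_eq j hj]
  exact rowSpan_mono _ hj (comb_mem_rowSpan _ _ _)

theorem finrank_rowSpan : Module.finrank K (rowSpan E.Y E.len) = E.len := by
  have := finrank_span_eq_card (R := K) hE.indep
  rw [← Set.image_eq_range] at this
  rw [rowSpan, this]
  simp

theorem len_le : E.len ≤ n := by
  have := (rowSpan E.Y E.len).finrank_le
  rwa [hE.finrank_rowSpan, Module.finrank_fin_fun] at this

/-- A linear combination of the rows of `S` that vanishes in the leading columns is trivial. -/
theorem eq_zero_of_coord_comb {a : ℕ → K} (h : ∀ i < E.len, coord (comb E.S E.len a) (E.l i) = 0) :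
    ∀ i < E.len, a i = 0 := by
  intro i
  induction i using Nat.strong_induction_on with
  | _ i ih =>
    intro hi
    have := h i hi
    rw [coord_comb, Finset.sum_eq_single i] at this
    · simpa [hE.pivot i hi] using this
    · intro j hj hne
      rcases lt_or_gt_of_ne hne with hlt | hgt
      · rw [ih j hlt (hlt.trans hi), zero_mul]
      · rw [hE.cleared j (Finset.mem_range.1 hj) i hgt, mul_zero]
    · simp [hi]

/-- After `i` rounds the loop has produced coefficients `a` and the vector `v - a S`, which vanishes
in the first `i` leading columns. -/
theorem cleanLoop_spec (v : Fin n → K) {i : ℕ} (hi : i ≤ E.len) :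
    (cleanLoop E v i).val.2 = v - comb E.S i (cleanLoop E v i).val.1 ∧
      ∀ j < i, coord (cleanLoop E v i).val.2 (E.l j) = 0 := by
  induction i with
  | zero => simp [cleanLoop, comb]
  | succ i ih =>
    obtain ⟨h₁, h₂⟩ := ih (Nat.le_of_succ_le hi)
    have hw : (cleanLoop E v (i + 1)).val.2 = (cleanLoop E v i).val.2 -
        coord (cleanLoop E v i).val.2 (E.l i) • E.S i := by
      funext j; simp [cleanLoop]
    have ha : (cleanLoop E v (i + 1)).val.1 = Function.update (cleanLoop E v i).val.1 i
        (coord (cleanLoop E v i).val.2 (E.l i)) := rfl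
    rw [hw, ha]
    constructor
    · rw [comb, Finset.sum_range_succ, Function.update_self, ← sub_sub]
      nth_rw 1 [h₁]
      congr 2
      exact comb_congr (fun _ _ => rfl) fun j hj => (Function.update_of_ne hj.ne _ _).symm
    · intro j hj
      change coordForm K n _ _ = 0
      rw [map_sub, map_smul]
      change coord _ _ - _ • coord _ _ = 0
      rcases Nat.lt_succ_iff_lt_or_eq.1 hj with hj | rfl
      · rw [h₂ j hj, hE.cleared i hi j hj, smul_zero, sub_zero]
      · rw [hE.pivot j hi, smul_eq_mul, mul_one, sub_self]

/-- A linear combination of the rows of `S` in terms of the rows of `Y`, since `S = T Y`. -/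
theorem comb_S (a : ℕ → K) :
    comb E.S E.len a = comb E.Y E.len (Counted.mulTriangular E.len a E.T).val := by
  have h₁ : comb E.S E.len a = ∑ i ∈ Finset.range E.len, ∑ j ∈ Finset.range (i + 1),
      (a i * E.T i j) • E.Y j :=
    Finset.sum_congr rfl fun i hi => by
      rw [hE.S_eq i (Finset.mem_range.1 hi), comb, Finset.smul_sum]
      simp only [smul_smul]
  have h₂ : comb E.Y E.len (Counted.mulTriangular E.len a E.T).val =
      ∑ j ∈ Finset.range E.len, ∑ i ∈ Finset.Ico j E.len, (a i * E.T i j) • E.Y j :=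
    Finset.sum_congr rfl fun j hj => by
      rw [Counted.val_mulTriangular, if_pos (Finset.mem_range.1 hj), Finset.sum_smul]
  rw [h₁, h₂]
  refine Finset.sum_comm' fun i j => ?_
  simp only [Finset.mem_range, Finset.mem_Ico]
  omega

/-- The step of CleanAndExtend that adds a vector `v` with a cleaned remainder `w ≠ 0`. -/
theorem extend {v w : Fin n → K} {a t : ℕ → K} {j : Fin n}
    (hv : v ∉ rowSpan E.Y E.len) (hw : w = v - comb E.S E.len a)
    (hl : ∀ i < E.len, coord w (E.l i) = 0) (hj : w j ≠ 0)
    (ht : ∀ i < E.len, t i = -(1 / w j) * (Counted.mulTriangular E.len a E.T).val i) :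
    Valid { len := E.len + 1
            Y := Function.update E.Y E.len v
            S := Function.update E.S E.len ((1 / w j) • w)
            T := Function.update E.T E.len (Function.update t E.len (1 / w j))
            l := Function.update E.l E.len j } := by
  have hY : ∀ i < E.len, Function.update E.Y E.len v i = E.Y i := fun i hi =>
    Function.update_of_ne hi.ne _ _
  have hS : ∀ i < E.len, Function.update E.S E.len ((1 / w j) • w) i = E.S i := fun i hi =>
    Function.update_of_ne hi.ne _ _
  have hcs : ∀ c, coord ((1 / w j) • w) c = 1 / w j * coord w c := fun c =>
    (coordForm K n c).map_smul _ _
  constructor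
  · intro i hi
    rcases Nat.lt_succ_iff_lt_or_eq.1 hi with hi | rfl
    · simp only [Function.update_of_ne hi.ne, hE.pivot i hi]
    · simp only [Function.update_self, hcs]
      simp [coord, hj]
  · intro i hi i' hi'
    rcases Nat.lt_succ_iff_lt_or_eq.1 hi with hi | rfl
    · simp only [Function.update_of_ne hi.ne, Function.update_of_ne (hi'.trans hi).ne,
        hE.cleared i hi i' hi']
    · simp only [Function.update_self, Function.update_of_ne hi'.ne, hcs, hl i' hi', mul_zero]
  · intro i hi
    rcases Nat.lt_succ_iff_lt_or_eq.1 hi with hi | rfl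
    · simp only [Function.update_of_ne hi.ne]
      rw [hE.S_eq i hi]
      exact comb_congr (fun i' hi' => (hY i' (by omega)).symm) fun _ _ => rfl
    · simp only [Function.update_self]
      have h : comb (Function.update E.Y E.len v) E.len
          (Function.update t E.len (1 / w j)) = -(1 / w j) • comb E.S E.len a := by
        rw [hE.comb_S, comb, comb, Finset.smul_sum]
        refine Finset.sum_congr rfl fun i hi => ?_
        have hi := Finset.mem_range.1 hi
        rw [hY i hi, Function.update_of_ne hi.ne, ht i hi, smul_smul]
      rw [comb, Finset.sum_range_succ, ← comb, h, Function.update_self, Function.update_self, hw]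
      module
  · exact linearIndepOn_update hE.indep hv
  · have hle : rowSpan E.S E.len ≤
        rowSpan (Function.update E.S E.len ((1 / w j) • w)) (E.len + 1) :=
      rowSpan_le.2 fun i hi => hS i hi ▸ mem_rowSpan_of_lt _ (by omega)
    intro i hi
    rcases Nat.lt_succ_iff_lt_or_eq.1 hi with hi | rfl
    · simp only [hY i hi]
      exact hle (hE.Y_mem i hi)
    · simp only [Function.update_self]
      have h : v = w j • ((1 / w j) • w) + comb E.S E.len a := by
        rw [smul_smul, mul_one_div_cancel hj, one_smul, hw, sub_add_cancel]
      rw [h]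
      refine add_mem (Submodule.smul_mem _ _ ?_) (hle (comb_mem_rowSpan _ _ _))
      have := mem_rowSpan_of_lt (Function.update E.S E.len ((1 / w j) • w)) (Nat.lt_succ_self E.len)
      rwa [Function.update_self] at this

end Valid

theorem cost_cleanLoop (E : SemiEchelon K n) (v : Fin n → K) (i : ℕ) :
    (cleanLoop E v i).cost = 2 * n * i := by
  induction i with
  | zero => simp [cleanLoop]
  | succ i ih => simp [cleanLoop, ih]; ring

/-- If `v` is in the row space, the data sequence is not changed. -/
theorem cleanAndExtend_of_mem {E : SemiEchelon K n} (hE : E.Valid) {v : Fin n → K}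
    (hv : v ∈ rowSpan E.Y E.len) :
    ∃ a, (cleanAndExtend E v).val = (true, E, a) ∧ v = comb E.S E.len a ∧
      (cleanAndExtend E v).cost = 2 * n * E.len := by
  obtain ⟨h₁, h₂⟩ := hE.cleanLoop_spec v le_rfl
  have hw : (cleanLoop E v E.len).val.2 = 0 := by
    have hm : (cleanLoop E v E.len).val.2 ∈ rowSpan E.S E.len := by
      rw [h₁]
      exact sub_mem (hE.rowSpan_S ▸ hv) (comb_mem_rowSpan _ _ _)
    obtain ⟨a, ha⟩ := mem_rowSpan.1 hm
    rw [← ha] at h₂ ⊢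
    exact Finset.sum_eq_zero fun j hj => by
      rw [hE.eq_zero_of_coord_comb h₂ j (Finset.mem_range.1 hj), zero_smul]
  refine ⟨(cleanLoop E v E.len).val.1, ?_, ?_, ?_⟩
  · simp [cleanAndExtend, hw]
  · rw [hw] at h₁
    exact sub_eq_zero.1 h₁.symm
  · simp [cleanAndExtend, hw, cost_cleanLoop]

open Classical in
/-- If `v` is not in the row space, the data sequence is extended by `v`. -/
theorem cleanAndExtend_of_notMem {E : SemiEchelon K n} (hE : E.Valid) {v : Fin n → K}
    (hv : v ∉ rowSpan E.Y E.len) :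
    ∃ E' a, (cleanAndExtend E v).val = (false, E', a) ∧ E'.Valid ∧ E'.len = E.len + 1 ∧
      E'.Y = Function.update E.Y E.len v ∧
      (cleanAndExtend E v).cost = 2 * n * E.len + (n + E.len * (E.len + 1) + E.len + 2) := by
  obtain ⟨h₁, h₂⟩ := hE.cleanLoop_spec v le_rfl
  unfold cleanAndExtend
  simp only [Counted.cost_bind, Counted.val_bind, cost_cleanLoop]
  split
  next hne =>
    have hwj := (Finset.mem_filter.1 (Finset.min'_mem _ hne)).2
    refine ⟨_, _, rfl, hE.extend hv h₁ h₂ hwj fun i hi => ?_, rfl, rfl, ?_⟩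
    · simp [hi]
    · simp [Counted.cost_mulTriangular]
      ring
  next hemp =>
    have hw : (cleanLoop E v E.len).val.2 = 0 := by
      funext j
      by_contra hj
      exact hemp ⟨j, by simpa using hj⟩
    rw [hw] at h₁
    exact absurd (sub_eq_zero.1 h₁.symm ▸ hE.rowSpan_S ▸ comb_mem_rowSpan _ _ _) hv

end SemiEchelon

/-! ### The action of polynomials on row vectors -/

/-- The polynomial `g` acts on row vectors by `v ↦ v g(M)`. -/
noncomputable def rowAct (M : Matrix (Fin n) (Fin n) K) : K[X] →ₐ[K] Module.End K (Fin n → K) :=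
  aeval (Matrix.vecMulLinear M)

theorem rowAct_mul (M : Matrix (Fin n) (Fin n) K) (g h : K[X]) (v : Fin n → K) :
    rowAct M (g * h) v = rowAct M g (rowAct M h v) := by
  rw [map_mul]; rfl

theorem rowAct_C_mul (M : Matrix (Fin n) (Fin n) K) (c : K) (g : K[X]) (v : Fin n → K) :
    rowAct M (C c * g) v = c • rowAct M g v := by
  rw [← smul_eq_C_mul, map_smul]; rfl

theorem rowAct_comm (M : Matrix (Fin n) (Fin n) K) (g h : K[X]) (v : Fin n → K) :
    rowAct M g (rowAct M h v) = rowAct M h (rowAct M g v) := by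
  rw [← rowAct_mul, mul_comm, rowAct_mul]

@[simp] theorem rowAct_X (M : Matrix (Fin n) (Fin n) K) (v : Fin n → K) :
    rowAct M X v = Matrix.vecMul v M := by
  simp [rowAct]

@[simp] theorem rowAct_one (M : Matrix (Fin n) (Fin n) K) (v : Fin n → K) :
    rowAct M 1 v = v := by
  simp [rowAct]

theorem rowAct_X_pow_succ (M : Matrix (Fin n) (Fin n) K) (i : ℕ) (v : Fin n → K) :
    rowAct M (X ^ (i + 1)) v = Matrix.vecMul (rowAct M (X ^ i) v) M := by
  rw [pow_succ', rowAct_mul, rowAct_X]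

theorem rowAct_X_pow_succ' (M : Matrix (Fin n) (Fin n) K) (i : ℕ) (v : Fin n → K) :
    rowAct M (X ^ (i + 1)) v = rowAct M (X ^ i) (Matrix.vecMul v M) := by
  rw [pow_succ, rowAct_mul, rowAct_X]

theorem rowAct_eq_vecMul (M : Matrix (Fin n) (Fin n) K) (g : K[X]) (v : Fin n → K) :
    rowAct M g v = Matrix.vecMul v (aeval M g) := by
  induction g using Polynomial.induction_on' generalizing v with
  | add p q hp hq => simp [hp, hq, Matrix.vecMul_add]
  | monomial i a =>
    rw [← C_mul_X_pow_eq_monomial, rowAct_C_mul, map_mul (aeval M), aeval_C, aeval_X_pow]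
    induction i generalizing v with
    | zero => simp [Algebra.algebraMap_eq_smul_one, Matrix.vecMul_smul]
    | succ i ih =>
      rw [rowAct_X_pow_succ', ih, Matrix.vecMul_vecMul, pow_succ', ← mul_assoc, ← mul_assoc,
        Algebra.commutes]

theorem minpoly_dvd_iff_rowAct (M : Matrix (Fin n) (Fin n) K) (g : K[X]) :
    minpoly K M ∣ g ↔ ∀ v, rowAct M g v = 0 := by
  rw [minpoly.dvd_iff]
  simp only [rowAct_eq_vecMul]
  constructor
  · intro h v; rw [h, Matrix.vecMul_zero]
  · intro h
    ext i j
    simpa using congrFun (h (Pi.single i 1)) j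

/-- A subspace that is invariant under `M` is invariant under all polynomials in `M`. -/
theorem rowAct_mem {M : Matrix (Fin n) (Fin n) K} {U : Submodule K (Fin n → K)}
    (hU : ∀ v ∈ U, Matrix.vecMul v M ∈ U) (g : K[X]) {v : Fin n → K} (hv : v ∈ U) :
    rowAct M g v ∈ U := by
  induction g using Polynomial.induction_on' generalizing v with
  | add p q hp hq => simpa using add_mem (hp hv) (hq hv)
  | monomial i a =>
    rw [← C_mul_X_pow_eq_monomial, rowAct_C_mul]
    refine Submodule.smul_mem _ _ ?_
    induction i with
    | zero => simpa using hv
    | succ i ih => rw [rowAct_X_pow_succ]; exact hU _ ih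

/-! ### Relative order polynomials -/

namespace SemiEchelon

/-- The number of operations for an extension of a data sequence of length `l` by one vector
and the multiplication of this vector by `M`. -/
def extendCost (n l : ℕ) : ℕ := 2 * n * l + (n + l * (l + 1) + l + 2) + 2 * n ^ 2

/-- The loop adds the vectors `v, v M, …, v M ^ (d - 1)`, where `d` is least such that `v M ^ d` lies
in the extended row space, and returns the coefficients of `v M ^ d` with respect to `S`. -/
theorem relLoop_spec (M : Matrix (Fin n) (Fin n) K) (r : ℕ) {E : SemiEchelon K n} (hE : E.Valid)
    (hr : n + 1 ≤ r + E.len) (v : Fin n → K) :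
    ∃ d E' a, (relLoop M r E v).val = (E', a) ∧ E'.Valid ∧ E'.len = E.len + d ∧
      (∀ i < E.len, E'.Y i = E.Y i) ∧ (∀ i < d, E'.Y (E.len + i) = rowAct M (X ^ i) v) ∧
      rowAct M (X ^ d) v = comb E'.S E'.len a ∧ (v ∉ rowSpan E.Y E.len → 0 < d) ∧
      (relLoop M r E v).cost =
        ∑ l ∈ Finset.Ico E.len (E.len + d), extendCost n l + 2 * n * (E.len + d) := by
  induction r generalizing E v with
  | zero =>
    have := hE.len_le
    omega
  | succ r ih =>
    by_cases hv : v ∈ rowSpan E.Y E.len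
    · obtain ⟨a, h₁, h₂, h₃⟩ := cleanAndExtend_of_mem hE hv
      refine ⟨0, E, a, ?_, hE, rfl, fun _ _ => rfl, by simp, by simpa using h₂,
        fun h => absurd hv h, ?_⟩
      · simp [relLoop, h₁]
      · simp [relLoop, h₁, h₃]
    · obtain ⟨E₁, a₁, h₁, hE₁, hlen, hY, hcost⟩ := cleanAndExtend_of_notMem hE hv
      obtain ⟨d, E', a, g₁, g₂, g₃, g₄, g₅, g₆, -, g₈⟩ :=
        ih hE₁ (by omega) (Matrix.vecMul v M)
      refine ⟨d + 1, E', a, ?_, g₂, by omega, fun i hi => ?_, fun i hi => ?_, ?_, by simp, ?_⟩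
      · simpa [relLoop, h₁, Counted.val_vecMul] using g₁
      · rw [g₄ i (by omega), hY, Function.update_of_ne hi.ne]
      · cases i with
        | zero =>
          rw [add_zero, g₄ _ (by omega), hY, Function.update_self]
          simp
        | succ i =>
          rw [rowAct_X_pow_succ', ← g₅ i (by omega), hlen]
          congr 1
          omega
      · rw [rowAct_X_pow_succ', g₆]
      · have : E.len < E.len + (d + 1) := by omega
        rw [Finset.sum_eq_sum_Ico_succ_bot this]
        simp only [relLoop, Counted.cost_bind, h₁, Counted.cost_vecMul,
          Counted.val_vecMul, Counted.cost_ite, hcost, g₈, hlen]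
        simp only [extendCost, Bool.false_eq_true, if_false]
        rw [show E.len + (d + 1) = E.len + 1 + d by omega]
        ring

/-- The polynomial `p` is read off from the part of `b` that belongs to the new rows, so that
`v p(M)` is the combination of the old rows with the remaining coefficients of `b`. -/
theorem relativeOrdPoly_spec (M : Matrix (Fin n) (Fin n) K) {E : SemiEchelon K n} (hE : E.Valid)
    (v : Fin n → K) :
    ∃ p E' b d, (relativeOrdPoly E v M).val = (p, E', b) ∧ E'.Valid ∧ E'.len = E.len + d ∧
      (∀ i < E.len, E'.Y i = E.Y i) ∧ (∀ i < d, E'.Y (E.len + i) = rowAct M (X ^ i) v) ∧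
      rowAct M (X ^ d) v = comb E'.Y E'.len b ∧ p.Monic ∧ p.natDegree = d ∧
      rowAct M p v = comb E.Y E.len b ∧ (v ∉ rowSpan E.Y E.len → 0 < d) ∧
      (relativeOrdPoly E v M).cost =
        ∑ l ∈ Finset.Ico E.len (E.len + d), extendCost n l + 2 * n * (E.len + d) +
          (E.len + d) * (E.len + d + 1) + d := by
  obtain ⟨d, E', a, h₁, h₂, h₃, h₄, h₅, h₆, h₇, h₈⟩ := relLoop_spec M (n + 1) hE (by omega) v
  have hd : E'.len - E.len = d := by omega
  rw [h₂.comb_S] at h₆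
  set b := (Counted.mulTriangular E'.len a E'.T).val with hb
  set p₀ := (Counted.poly d fun i => Counted.sub 0 (b (E.len + i))).val with hp
  have hdeg : p₀.degree < d := by
    rw [degree_lt_iff_coeff_zero]
    intro m hm
    rw [hp, Counted.coeff_poly, if_neg (by omega)]
  have hact : rowAct M p₀ v = - comb (fun j => E'.Y (E.len + j)) d fun j => b (E.len + j) := by
    rw [hp, Counted.poly, map_sum, LinearMap.sum_apply, comb, ← Finset.sum_neg_distrib]
    refine Finset.sum_congr rfl fun i hi => ?_
    rw [← C_mul_X_pow_eq_monomial, rowAct_C_mul, ← h₅ i (Finset.mem_range.1 hi)]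
    simp
  refine ⟨X ^ d + p₀, E', b, d, ?_, h₂, h₃, h₄, h₅, h₆, monic_X_pow_add hdeg,
    natDegree_eq_of_degree_eq_some ?_, ?_, h₇, ?_⟩
  · simp only [relativeOrdPoly, Counted.val_bind, Counted.val_pure, h₁, hd]
    rfl
  · rw [degree_add_eq_left_of_degree_lt (by rwa [degree_X_pow]), degree_X_pow]
  · rw [map_add, LinearMap.add_apply, hact, h₆, h₃, comb_add, add_neg_cancel_right]
    exact comb_congr h₄ fun _ _ => rfl
  · simp only [relativeOrdPoly, Counted.cost_bind, h₁, h₈,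
      Counted.cost_mulTriangular, Counted.cost_pure, Counted.cost_poly, Counted.cost_sub, h₃]
    simp
    ring

end SemiEchelon

/-! ### Runs of randomised programs -/

namespace Prog

theorem mem_support_bind {α β : Type u} {x : Prog α} {f : α → Prog β} {r : β × Tally} :
    r ∈ (x >>= f).law.support ↔ ∃ s ∈ x.law.support, ∃ t ∈ (f s.1).law.support,
      r = (t.1, ⟨s.2.ops + t.2.ops, s.2.draws ++ t.2.draws⟩) := by
  change r ∈ PMF.support (PMF.bind _ _) ↔ _
  simp only [PMF.mem_support_bind_iff, PMF.support_pure, Set.mem_singleton_iff]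

theorem mem_support_pure {α : Type u} {a : α} {r : α × Tally} :
    r ∈ (pure a : Prog α).law.support ↔ r = (a, ⟨0, []⟩) := by
  change r ∈ PMF.support (PMF.pure _) ↔ _
  simp

theorem mem_support_det {α : Type u} {x : Counted α} {r : α × Tally} :
    r ∈ (det x).law.support ↔ r = (x.val, ⟨x.cost, []⟩) := by
  simp [det]

theorem mem_support_randomVector [Fintype K] {m : ℕ} {r : (ℕ → K) × Tally} :
    r ∈ (randomVector K m).law.support ↔ ∃ a : Fin m → K, r = (coord a, ⟨0, [m]⟩) := by
  simp [randomVector, eq_comm]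

/-- The complement from which the non-zero vector is drawn is non-trivial, so that
`Prog.randomVectorNeZero` does not use its default value. -/
theorem exists_coord_eq_zero {E : SemiEchelon K n} (hE : E.Valid) (h : E.len < n) :
    ∃ c : Fin n → K, c ≠ 0 ∧ ∀ i < E.len, coord c (E.l i) = 0 := by
  have hlt : rowSpan E.Y E.len < ⊤ := by
    rw [lt_top_iff_ne_top]
    intro htop
    have := hE.finrank_rowSpan
    rw [htop, finrank_top, Module.finrank_fin_fun] at this
    omega
  obtain ⟨v, -, hv⟩ := SetLike.exists_of_lt hlt
  obtain ⟨h₁, h₂⟩ := hE.cleanLoop_spec v le_rfl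
  refine ⟨_, fun h₀ => hv ?_, h₂⟩
  rw [h₀] at h₁
  exact sub_eq_zero.1 h₁.symm ▸ hE.rowSpan_S ▸ comb_mem_rowSpan _ _ _

theorem of_mem_support_randomVectorNeZero [Fintype K] {E : SemiEchelon K n} (hE : E.Valid)
    (h : E.len < n) {r : (Fin n → K) × Tally} (hr : r ∈ (randomVectorNeZero E).law.support) :
    r.1 ≠ 0 ∧ (∀ i < E.len, coord r.1 (E.l i) = 0) ∧ r.2 = ⟨0, [n - E.len]⟩ := by
  obtain ⟨c, hc₀, hc⟩ := exists_coord_eq_zero hE h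
  unfold randomVectorNeZero at hr
  dsimp only at hr
  split at hr
  · obtain ⟨c, hc, rfl⟩ := (PMF.mem_support_map_iff _ _ _).1 hr
    simpa using hc
  next hemp => exact absurd ⟨c, by simpa using ⟨hc₀, hc⟩⟩ hemp

end Prog

/-! ### The invariant of CharPoly -/

namespace CharData

theorem s_succ (D : CharData K n) (i : ℕ) : D.s (i + 1) = D.s i + (D.p i).natDegree :=
  Finset.sum_range_succ _ _

@[simp] theorem s_zero (D : CharData K n) : D.s 0 = 0 := rfl

theorem s_mono (D : CharData K n) : Monotone D.s :=
  monotone_nat_of_le_succ fun i => by rw [s_succ]; omega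

/-- The invariants of CharPoly: the rows of `Y` are the vectors `v i * M ^ c` with
`c < (p i).natDegree`, where `v i` is the row with index `s i`, and `p i` and `b i` are the relative
order polynomial of `v i` and the expression of `v i * M ^ (p i).natDegree` in the rows of `Y`. -/
structure Valid (M : Matrix (Fin n) (Fin n) K) (D : CharData K n) : Prop where
  E_valid : D.E.Valid
  len_eq : D.E.len = D.s D.k
  monic : ∀ i < D.k, (D.p i).Monic
  pos : ∀ i < D.k, 0 < (D.p i).natDegree
  Y_eq : ∀ i < D.k, ∀ c < (D.p i).natDegree,
    D.E.Y (D.s i + c) = rowAct M (X ^ c) (D.E.Y (D.s i))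
  b_eq : ∀ i < D.k,
    rowAct M (X ^ (D.p i).natDegree) (D.E.Y (D.s i)) = comb D.E.Y (D.s (i + 1)) (D.b i)
  p_mem : ∀ i < D.k, rowAct M (D.p i) (D.E.Y (D.s i)) ∈ rowSpan D.E.Y (D.s i)

/-- The data after one more round of CharPoly in which the vector `v` has been chosen. -/
noncomputable def next (M : Matrix (Fin n) (Fin n) K) (D : CharData K n) (v : Fin n → K) :
    CharData K n :=
  { k := D.k + 1
    p := Function.update D.p D.k (relativeOrdPoly D.E v M).val.1
    E := (relativeOrdPoly D.E v M).val.2.1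
    b := Function.update D.b D.k (relativeOrdPoly D.E v M).val.2.2 }

/-- `D'` results from `D` by further rounds of CharPoly. -/
structure Extends (D D' : CharData K n) : Prop where
  k_le : D.k ≤ D'.k
  p_eq : ∀ i < D.k, D'.p i = D.p i
  Y_eq : ∀ j < D.s D.k, D'.E.Y j = D.E.Y j

theorem Extends.s_eq {D D' : CharData K n} (h : D.Extends D') {i : ℕ} (hi : i ≤ D.k) :
    D'.s i = D.s i :=
  Finset.sum_congr rfl fun j hj => by rw [h.p_eq j ((Finset.mem_range.1 hj).trans_le hi)]

theorem Extends.refl (D : CharData K n) : D.Extends D :=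
  ⟨le_rfl, fun _ _ => rfl, fun _ _ => rfl⟩

theorem Extends.trans {D D' D'' : CharData K n} (h : D.Extends D') (h' : D'.Extends D'') :
    D.Extends D'' where
  k_le := h.k_le.trans h'.k_le
  p_eq i hi := (h'.p_eq i (hi.trans_le h.k_le)).trans (h.p_eq i hi)
  Y_eq j hj := by
    refine (h'.Y_eq j (hj.trans_le ?_)).trans (h.Y_eq j hj)
    rw [← h.s_eq le_rfl]
    exact D'.s_mono h.k_le

/-- An upper bound for the number of operations of CharPoly that can be charged to the row of `Y` with
index `l`: its extension step and, as if it were both the first and the last row of its round, the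
formation of the random vector, the final reduction, and the computation of `b`. -/
def roundCost (n l : ℕ) : ℕ :=
  SemiEchelon.extendCost n l + 2 * n * l + 2 * n * (l + 1) + (l + 1) * (l + 2) + 1

theorem cost_le_sum_roundCost (n l : ℕ) {d : ℕ} (hd : 0 < d) :
    2 * n * l + (∑ i ∈ Finset.Ico l (l + d), SemiEchelon.extendCost n i + 2 * n * (l + d) +
          (l + d) * (l + d + 1) + d) ≤ ∑ i ∈ Finset.Ico l (l + d), roundCost n i := by
  induction d, hd using Nat.le_induction with
  | base => simp [roundCost]; linarith
  | succ d hd ih =>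
    rw [← add_assoc l d 1, Finset.sum_Ico_succ_top (by omega), Finset.sum_Ico_succ_top (by omega),
      roundCost]
    nlinarith

/-- A round of CharPoly preserves the invariants. -/
theorem Valid.next {M : Matrix (Fin n) (Fin n) K} {D : CharData K n} (hD : D.Valid M)
    {v : Fin n → K} (hv : v ∉ rowSpan D.E.Y D.E.len) :
    (D.next M v).Valid M ∧ D.Extends (D.next M v) ∧ (D.next M v).E.Y (D.s D.k) = v ∧
      D.E.len < (D.next M v).E.len ∧
      2 * n * D.E.len + (relativeOrdPoly D.E v M).cost ≤
        ∑ i ∈ Finset.Ico D.E.len (D.next M v).E.len, roundCost n i := by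
  obtain ⟨p, E', b, d, h₁, h₂, h₃, h₄, h₅, h₆, h₇, h₈, h₉, h₁₀, h₁₁⟩ :=
    SemiEchelon.relativeOrdPoly_spec M hD.E_valid v
  have hd := h₁₀ hv
  have hn : D.next M v = ⟨D.k + 1, Function.update D.p D.k p, E', Function.update D.b D.k b⟩ := by
    simp only [CharData.next, h₁]
  rw [hn]
  have hext : D.Extends ⟨D.k + 1, Function.update D.p D.k p, E', Function.update D.b D.k b⟩ :=
    ⟨Nat.le_succ _, fun i hi => Function.update_of_ne hi.ne _ _, fun j hj =>
      h₄ j (hD.len_eq ▸ hj)⟩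
  set D' : CharData K n :=
    ⟨D.k + 1, Function.update D.p D.k p, E', Function.update D.b D.k b⟩ with hD'
  have hs : ∀ i ≤ D.k, D'.s i = D.s i := fun i hi => hext.s_eq hi
  have hpk : D'.p D.k = p := Function.update_self _ _ _
  have hp : ∀ i < D.k, D'.p i = D.p i := hext.p_eq
  have hbk : D'.b D.k = b := Function.update_self _ _ _
  have hb : ∀ i < D.k, D'.b i = D.b i := fun i hi => Function.update_of_ne hi.ne _ _
  have hY : ∀ j < D.s D.k, D'.E.Y j = D.E.Y j := hext.Y_eq
  have hlt : ∀ i < D.k, D.s i + (D.p i).natDegree ≤ D.s D.k := fun i hi => by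
    rw [← s_succ]; exact D.s_mono hi
  have hYk : D'.E.Y (D.s D.k) = v := by
    have := h₅ 0 hd
    rwa [hD.len_eq, add_zero, pow_zero, rowAct_one] at this
  have hYi : ∀ i < D.k, D'.E.Y (D.s i) = D.E.Y (D.s i) := fun i hi =>
    hY _ (by have := hlt i hi; have := hD.pos i hi; omega)
  have hlen : E'.len = D'.s (D.k + 1) := by
    rw [s_succ, hpk, hs _ le_rfl, h₃, h₈, hD.len_eq]
  refine ⟨⟨h₂, hlen, ?_, ?_, ?_, ?_, ?_⟩, hext, hYk, ?_, ?_⟩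
  · intro i hi
    rcases Nat.lt_succ_iff_lt_or_eq.1 hi with hi | rfl
    · rw [hp i hi]; exact hD.monic i hi
    · rwa [hpk]
  · intro i hi
    rcases Nat.lt_succ_iff_lt_or_eq.1 hi with hi | rfl
    · rw [hp i hi]; exact hD.pos i hi
    · rwa [hpk, h₈]
  · intro i hi c hc
    rcases Nat.lt_succ_iff_lt_or_eq.1 hi with hi | rfl
    · rw [hp i hi] at hc
      rw [hs i hi.le, hYi i hi, hY _ (by have := hlt i hi; omega)]
      exact hD.Y_eq i hi c hc
    · rw [hpk, h₈] at hc
      rw [hs _ le_rfl, hYk, ← hD.len_eq]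
      exact h₅ c hc
  · intro i hi
    rcases Nat.lt_succ_iff_lt_or_eq.1 hi with hi | rfl
    · rw [hp i hi, hs i hi.le, hYi i hi, hs (i + 1) hi, hb i hi, hD.b_eq i hi]
      exact comb_congr (fun j hj => (hY j (hj.trans_le (D.s_mono hi))).symm) fun _ _ => rfl
    · rw [hpk, h₈, hs _ le_rfl, hYk, ← hlen, hbk, h₆]
  · intro i hi
    rcases Nat.lt_succ_iff_lt_or_eq.1 hi with hi | rfl
    · rw [hp i hi, hs i hi.le, hYi i hi,
        rowSpan_congr fun j hj => hY j (hj.trans_le (D.s_mono hi.le))]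
      exact hD.p_mem i hi
    · rw [hpk, hs _ le_rfl, hYk, h₉, rowSpan_congr hY, ← hD.len_eq]
      exact comb_mem_rowSpan _ _ _
  · change D.E.len < E'.len
    omega
  · rw [h₁₁]
    change _ ≤ ∑ i ∈ Finset.Ico D.E.len E'.len, _
    rw [h₃]
    exact cost_le_sum_roundCost n D.E.len hd

end CharData

theorem val_sum_smul (c : Fin n → K) (a : ℕ → K) (S : ℕ → Fin n → K) (m : ℕ) :
    (Counted.vec fun j => Counted.accumulate (c j) (List.range m)
      fun i => Counted.mul (a i) (S i j)).val = c + comb S m a := by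
  funext j
  simp [comb, Finset.sum_apply]
  rfl

theorem cost_sum_smul (c : Fin n → K) (a : ℕ → K) (S : ℕ → Fin n → K) (m : ℕ) :
    (Counted.vec fun j => Counted.accumulate (c j) (List.range m)
      fun i => Counted.mul (a i) (S i j)).cost = 2 * n * m := by
  simp; ring

/-- The sum of a non-zero element of the complement and an element of the row space is not in the row
space. -/
theorem add_comb_notMem {E : SemiEchelon K n} (hE : E.Valid) {c : Fin n → K} (hc : c ≠ 0)
    (hl : ∀ i < E.len, coord c (E.l i) = 0) (a : ℕ → K) :
    c + comb E.S E.len a ∉ rowSpan E.Y E.len := by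
  rw [← hE.rowSpan_S]
  intro h
  obtain ⟨a', rfl⟩ := mem_rowSpan.1 ((Submodule.add_mem_iff_left _ (comb_mem_rowSpan _ _ _)).1 h)
  exact hc (Finset.sum_eq_zero fun j hj => by
    rw [hE.eq_zero_of_coord_comb hl j (Finset.mem_range.1 hj), zero_smul])

/-- What holds after every run of CharPoly. For the draws, a round with a row space of dimension `l`
costs `ξ l + ξ (n - l) ≤ ξ n`. -/
theorem charLoop_spec [Fintype K] (M : Matrix (Fin n) (Fin n) K) (R : ℕ) {D : CharData K n}
    (hD : D.Valid M) (hR : n ≤ R + D.E.len) {r : CharData K n × Tally}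
    (hr : r ∈ (charLoop M R D).law.support) :
    r.1.Valid M ∧ r.1.E.len = n ∧ D.Extends r.1 ∧
      r.2.ops ≤ ∑ i ∈ Finset.Ico D.E.len n, CharData.roundCost n i ∧
      ∀ ξ, IsDrawCost ξ → (r.2.draws.map ξ).sum + D.k * ξ n ≤ r.1.k * ξ n := by
  induction R generalizing D r with
  | zero =>
    have := hD.E_valid.len_le
    obtain rfl := Prog.mem_support_pure.1 hr
    exact ⟨hD, by dsimp only; omega, .refl D, by simp, fun ξ _ => by simp⟩
  | succ R ih =>
    rw [charLoop] at hr
    split at hr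
    next hlt =>
      obtain ⟨a, ha, r₁, hr₁, rfl⟩ := Prog.mem_support_bind.1 hr
      obtain ⟨c, hc, r₂, hr₂, rfl⟩ := Prog.mem_support_bind.1 hr₁
      obtain ⟨v, hv, r₃, hr₃, rfl⟩ := Prog.mem_support_bind.1 hr₂
      obtain ⟨x, hx, r₄, hr₄, rfl⟩ := Prog.mem_support_bind.1 hr₃
      obtain ⟨a, rfl⟩ := Prog.mem_support_randomVector.1 ha
      obtain ⟨c, tc⟩ := c
      obtain ⟨hc₀, hc, rfl⟩ := Prog.of_mem_support_randomVectorNeZero hD.E_valid hlt hc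
      rw [Prog.mem_support_det, val_sum_smul, cost_sum_smul] at hv
      subst hv
      rw [Prog.mem_support_det] at hx
      subst hx
      have hv : c + comb D.E.S D.E.len (coord a) ∉ rowSpan D.E.Y D.E.len :=
        add_comb_notMem hD.E_valid hc₀ hc (coord a)
      obtain ⟨h₁, h₂, h₃, h₄, h₅⟩ := hD.next hv
      dsimp only at ⊢
      have hle := h₁.E_valid.len_le
      obtain ⟨g₁, g₂, g₃, g₄, g₅⟩ := ih h₁ (by omega) hr₄
      refine ⟨g₁, g₂, h₂.trans g₃, ?_, fun ξ hξ => ?_⟩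
      · rw [← Finset.sum_Ico_consecutive _ h₄.le hle]
        omega
      · have hg := g₅ ξ hξ
        have hξn := hξ.2.2 D.E.len (n - D.E.len)
        rw [Nat.add_sub_cancel' hlt.le] at hξn
        have : ((D.next M (c + comb D.E.S D.E.len (coord a))).k : ℝ) = D.k + 1 := by
          simp [CharData.next]
        rw [this] at hg
        simp
        linarith
    next hlt =>
      have := hD.E_valid.len_le
      obtain rfl := Prog.mem_support_pure.1 hr
      exact ⟨hD, by dsimp only; omega, .refl D, by simp, fun ξ _ => by simp⟩

theorem CharData.valid_init (M : Matrix (Fin n) (Fin n) K) :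
    CharData.Valid M { k := 0, p := 0, E := SemiEchelon.trivial K n, b := 0 } :=
  ⟨SemiEchelon.valid_trivial, rfl, by simp, by simp, by simp, by simp, by simp⟩

theorem charPoly_spec [Fintype K] (M : Matrix (Fin n) (Fin n) K) {r : CharData K n × Tally}
    (hr : r ∈ (charPoly M).law.support) :
    r.1.Valid M ∧ r.1.E.len = n ∧
      r.2.ops ≤ ∑ i ∈ Finset.range n, CharData.roundCost n i ∧
      ∀ ξ, IsDrawCost ξ → (r.2.draws.map ξ).sum ≤ r.1.k * ξ n := by
  obtain ⟨h₁, h₂, -, h₃, h₄⟩ := charLoop_spec M n (CharData.valid_init M) (by simp) hr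
  refine ⟨h₁, h₂, by rwa [Finset.range_eq_Ico], fun ξ hξ => by simpa using h₄ ξ hξ⟩

/-! ### Division of polynomials -/

/-- Since `q` is monic, every round removes the leading term, and the computed array of coefficients
is that of `h - c * q * X ^ i`. -/
theorem divMod_spec {q : K[X]} (hq : q.Monic) (r : ℕ) {h : K[X]}
    (hh : ∀ j, q.natDegree + r ≤ j → h.coeff j = 0) :
    h = q * (divMod q r h).val.1 + (divMod q r h).val.2 ∧
      (∀ j, q.natDegree ≤ j → (divMod q r h).val.2.coeff j = 0) ∧
      (divMod q r h).cost = 2 * q.natDegree * r := by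
  induction r generalizing h with
  | zero => exact ⟨by simp [divMod], hh, by simp [divMod]⟩
  | succ i ih =>
    set c := h.coeff (q.natDegree + i) with hc
    set s : Counted K[X] := Counted.poly (q.natDegree + i) fun j =>
        if i ≤ j then do
          let t ← Counted.mul c (q.coeff (j - i))
          Counted.sub (h.coeff j) t
        else
          pure (h.coeff j) with hs
    have hval : s.val = h - q * monomial i c := by
      ext j
      rw [hs, Counted.coeff_poly, coeff_sub, ← C_mul_X_pow_eq_monomial, mul_left_comm, coeff_C_mul,
        coeff_mul_X_pow']
      split_ifs with h₁ h₂
      · simp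
      · simp
      next h₂ =>
        rcases (not_lt.1 h₁).eq_or_lt with rfl | hlt
        · simp [hq, hc]
        · rw [hh j (by omega), coeff_eq_zero_of_natDegree_lt (by omega)]
          simp
      · omega
    have hcost : s.cost = 2 * q.natDegree := by
      rw [hs, Counted.cost_poly, add_comm, Finset.sum_range_add, Finset.sum_eq_zero]
      · simp; ring
      · intro j hj
        simp [not_le.2 (Finset.mem_range.1 hj)]
    obtain ⟨h₁, h₂, h₃⟩ := ih (h := s.val) fun j hj => by
      rw [hs, Counted.coeff_poly, if_neg (by omega)]
    refine ⟨?_, h₂, ?_⟩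
    · change h = q * ((divMod q i s.val).val.1 + monomial i c) + (divMod q i s.val).val.2
      rw [mul_add, add_right_comm, ← h₁, hval, sub_add_cancel]
    · change s.cost + ((divMod q i s.val).cost + 0) = _
      rw [h₃, hcost]
      ring

/-- The cofactor of `q ^ e` in `h` is the least power `q ^ m` with `q ^ e ∣ q ^ m * h`. -/
theorem cofactor_spec {q : K[X]} (hq : q.Monic) (hq' : Irreducible q) (e : ℕ) {h : K[X]} {d : ℕ}
    (h0 : h ≠ 0) (hd : h.natDegree < d) :
    ∃ m ≤ e, (cofactor q e h).val = List.replicate m q ∧ (∀ f, q ^ e ∣ f * h ↔ q ^ m ∣ f) ∧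
      (cofactor q e h).cost ≤ e * q.natDegree * (2 * d) := by
  have hpos := hq'.natDegree_pos
  induction e generalizing h with
  | zero => exact ⟨0, le_rfl, by simp [cofactor], by simp, by simp [cofactor]⟩
  | succ e ih =>
    have hfull : ¬ q ∣ h → ∀ f, q ^ (e + 1) ∣ f * h ↔ q ^ (e + 1) ∣ f := fun hn f =>
      ⟨fun hf => ((hq'.coprime_iff_not_dvd.2 hn).pow_left).dvd_of_dvd_mul_right hf,
        fun hf => hf.mul_right h⟩
    unfold cofactor
    split
    next hlt =>
      exact ⟨e + 1, le_rfl, rfl, hfull fun hdvd => absurd (natDegree_le_of_dvd hdvd h0) (by omega),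
        by simp⟩
    next hle =>
      obtain ⟨h₁, h₂, h₃⟩ := divMod_spec hq (h.natDegree - q.natDegree + 1) (h := h) fun j hj =>
        coeff_eq_zero_of_natDegree_lt (by omega)
      have hc : (divMod q (h.natDegree - q.natDegree + 1) h).cost ≤ q.natDegree * (2 * d) := by
        rw [h₃, mul_comm 2, mul_assoc]
        gcongr
        omega
      set x := divMod q (h.natDegree - q.natDegree + 1) h
      simp only [Counted.val_bind, Counted.cost_bind, Counted.val_ite, Counted.cost_ite]
      split_ifs with hx
      · rw [hx, add_zero] at h₁
        have hx0 : x.val.1 ≠ 0 := by rintro hx0; rw [hx0, mul_zero] at h₁; exact h0 h₁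
        obtain ⟨m, g₁, g₂, g₃, g₄⟩ := ih hx0 (by
          rw [h₁, natDegree_mul hq'.ne_zero hx0] at hd
          omega)
        refine ⟨m, by omega, g₂, fun f => ?_, by linarith⟩
        rw [← g₃, h₁, pow_succ', mul_left_comm, mul_dvd_mul_iff_left hq'.ne_zero]
      · refine ⟨e + 1, le_rfl, rfl, hfull fun hdvd => hx ?_, ?_⟩
        · rw [h₁, dvd_add_right (dvd_mul_right _ _)] at hdvd
          by_contra hx
          have := natDegree_le_of_dvd hdvd hx
          exact hx (leadingCoeff_eq_zero.1 (h₂ _ this))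
        · simp only [Counted.cost_pure, add_zero]
          refine hc.trans ?_
          rw [mul_assoc]
          exact Nat.le_mul_of_pos_left _ (Nat.succ_pos e)

theorem IsCoprime.list_prod_right {R : Type*} [CommRing R] {x : R} {l : List R}
    (h : ∀ y ∈ l, IsCoprime x y) : IsCoprime x l.prod := by
  induction l with
  | nil => simpa using isCoprime_one_right
  | cons y l ih =>
    rw [List.prod_cons]
    exact (h y (by simp)).mul_right (ih fun z hz => h z (by simp [hz]))

theorem isCoprime_of_monic_irreducible {p q : K[X]} (hp : p.Monic) (hp' : Irreducible p)
    (hq : q.Monic) (hq' : Irreducible q) (h : p ≠ q) : IsCoprime p q :=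
  hp'.coprime_iff_not_dvd.2 fun hdvd =>
    h (eq_of_monic_of_associated hp hq (hp'.associated_of_dvd hq' hdvd))

theorem IsCoprime.mul_dvd_iff {R : Type*} [CommRing R] {x y z : R} (h : IsCoprime x y) :
    x * y ∣ z ↔ x ∣ z ∧ y ∣ z :=
  ⟨fun hz => ⟨dvd_of_mul_right_dvd hz, dvd_of_mul_left_dvd hz⟩, fun hz => h.mul_dvd hz.1 hz.2⟩

open Classical in
/-- The cofactors of the powers of distinct irreducible polynomials can be combined, since the powers
are coprime. -/
theorem cofactors_spec (L : List K[X]) {h : K[X]} {d : ℕ} (h0 : h ≠ 0) (hd : h.natDegree < d)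
    {qs : List K[X]} (hqs : ∀ q ∈ qs, q.Monic ∧ Irreducible q) (hnd : qs.Nodup) :
    (∀ q ∈ (cofactors L h qs).val, q ∈ qs) ∧
      ((cofactors L h qs).val.map natDegree).sum ≤
        (qs.map fun q => L.count q * q.natDegree).sum ∧
      (∀ f, (qs.map fun q => q ^ L.count q).prod ∣ f * h ↔ (cofactors L h qs).val.prod ∣ f) ∧
      (cofactors L h qs).cost ≤ (qs.map fun q => L.count q * q.natDegree).sum * (2 * d) := by
  induction qs with
  | nil => simp [cofactors]
  | cons q qs ih =>
    obtain ⟨hq, hqs'⟩ := List.forall_mem_cons.1 hqs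
    obtain ⟨hnot, hnd⟩ := List.nodup_cons.1 hnd
    obtain ⟨h₁, h₂, h₃, h₄⟩ := ih hqs' hnd
    obtain ⟨m, g₁, g₂, g₃, g₄⟩ := cofactor_spec hq.1 hq.2 (L.count q) h0 hd
    have hcop : ∀ y ∈ qs, IsCoprime q y := fun y hy =>
      isCoprime_of_monic_irreducible hq.1 hq.2 (hqs' y hy).1 (hqs' y hy).2
        fun hqy => hnot (hqy ▸ hy)
    have hval : (cofactors L h (q :: qs)).val = List.replicate m q ++ (cofactors L h qs).val := by
      rw [← g₂]; rfl
    have hcost : (cofactors L h (q :: qs)).cost =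
        (cofactor q (L.count q) h).cost + (cofactors L h qs).cost := by
      simp [cofactors]
    rw [hval, hcost]
    refine ⟨?_, ?_, fun f => ?_, ?_⟩
    · simp only [List.mem_append, List.mem_replicate, List.mem_cons]
      rintro x (hx | hx)
      · exact Or.inl hx.2
      · exact Or.inr (h₁ x hx)
    · simp only [List.map_append, List.map_replicate, List.sum_append, List.sum_replicate,
        List.map_cons, List.sum_cons, smul_eq_mul]
      gcongr
    · rw [List.map_cons, List.prod_cons, List.prod_append, List.prod_replicate,
        IsCoprime.mul_dvd_iff, IsCoprime.mul_dvd_iff, g₃, h₃]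
      · exact (IsCoprime.list_prod_right fun y hy => hcop y (h₁ y hy)).pow_left
      · refine (IsCoprime.list_prod_right fun y hy => ?_).pow_left
        obtain ⟨z, hz, rfl⟩ := List.mem_map.1 hy
        exact (hcop z hz).pow_right
    · rw [List.map_cons, List.sum_cons, add_mul]
      gcongr

theorem natDegree_list_prod_of_monic {L : List K[X]} (hL : ∀ q ∈ L, q.Monic) :
    L.prod.natDegree = (L.map natDegree).sum := by
  simpa using natDegree_multiset_prod_of_monic (L : Multiset K[X]) (by simpa using hL)

open Classical in
/-- The list `g` of the factors of `p / gcd(h, p)`: a multiple of `h` by `f` is divisible by `p` if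
and only if `f` is divisible by the product of `g`. -/
theorem cofactors_dedup_spec {L : List K[X]}
    (hL : ∀ q ∈ L, q.Monic ∧ Irreducible q) {h : K[X]} (h0 : h ≠ 0)
    (hd : h.natDegree < L.prod.natDegree) :
    (∀ q ∈ (cofactors L h L.dedup).val, q.Monic ∧ Irreducible q) ∧
      ((cofactors L h L.dedup).val.map natDegree).sum ≤ L.prod.natDegree ∧
      (∀ f, L.prod ∣ f * h ↔ (cofactors L h L.dedup).val.prod ∣ f) ∧
      (cofactors L h L.dedup).cost ≤ 2 * L.prod.natDegree ^ 2 := by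
  obtain ⟨h₁, h₂, h₃, h₄⟩ := cofactors_spec L h0 hd (qs := L.dedup)
    (fun q hq => hL q (List.mem_dedup.1 hq)) (List.nodup_dedup L)
  have hs : (L.dedup.map fun q => L.count q * q.natDegree).sum = L.prod.natDegree := by
    rw [natDegree_list_prod_of_monic fun q hq => (hL q hq).1, Finset.sum_list_map_count L]
    rfl
  have hp : (L.dedup.map fun q => q ^ L.count q).prod = L.prod := by
    rw [Finset.prod_list_count L]
    rfl
  rw [hs] at h₂ h₄
  rw [hp] at h₃
  exact ⟨fun q hq => hL q (List.mem_dedup.1 (h₁ q hq)), h₂, h₃, h₄.trans (by nlinarith)⟩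

/-! ### Order polynomials -/

/-- Linearly independent rows: a combination that lies in the span of the first `m'` rows has no
coefficients from position `m'` on. -/
theorem coeff_eq_zero_of_comb_mem_rowSpan {Y : ℕ → Fin n → K} {N m m' : ℕ} {a : ℕ → K}
    (hY : LinearIndepOn K Y (Finset.range N : Set ℕ)) (hm : m ≤ N)
    (h : comb Y m a ∈ rowSpan Y m') : ∀ j < m, m' ≤ j → a j = 0 := by
  intro j hj hj'
  obtain ⟨a', ha'⟩ := mem_rowSpan.1 h
  have h₁ := linearIndepOn_finset_iff.1 hY
    (fun i => (if i < m then a i else 0) - if i < m' then a' i else 0) ?_ j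
    (Finset.mem_range.2 (hj.trans_le hm))
  · simpa [hj, hj'.not_gt] using h₁
  · have h₂ : ∀ m ≤ N, ∀ a : ℕ → K,
        ∑ i ∈ Finset.range N, (if i < m then a i else 0) • Y i = comb Y m a := by
      intro m hm a
      rw [comb, ← Finset.sum_subset (Finset.range_mono hm)]
      · exact Finset.sum_congr rfl fun i hi => by rw [if_pos (Finset.mem_range.1 hi)]
      · intro i _ hi
        rw [if_neg (by simpa using hi), zero_smul]
    simp only [sub_smul, Finset.sum_sub_distrib]
    rw [h₂ m hm, h₂ m' (by omega), ha', sub_self]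

theorem natDegree_sum_monomial_lt {d : ℕ} (hd : 0 < d) (a : ℕ → K) :
    (∑ j ∈ Finset.range d, monomial j (a j)).natDegree < d := by
  refine Nat.lt_of_le_pred hd (natDegree_sum_le_of_forall_le _ _ fun j hj => ?_)
  have := Finset.mem_range.1 hj
  exact (natDegree_monomial_le _).trans (Nat.le_pred_of_lt this)

namespace CharData

/-- The sum `s 1 + ⋯ + s z`. -/
def sumS (D : CharData K n) (z : ℕ) : ℕ := ∑ j ∈ Finset.range z, D.s (j + 1)

theorem sum_range_s {A : Type*} [AddCommMonoid A] (D : CharData K n) (z : ℕ) (f : ℕ → A) :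
    ∑ c ∈ Finset.range (D.s z), f c =
      ∑ i ∈ Finset.range z, ∑ c ∈ Finset.range (D.p i).natDegree, f (D.s i + c) := by
  induction z with
  | zero => simp
  | succ z ih => rw [s_succ, Finset.sum_range_add, ih, Finset.sum_range_succ]

theorem val_mulSparse (D : CharData K n) (z : ℕ) (w : ℕ → K) {c : ℕ} (hc : c < D.s z) :
    (mulSparse D z w).val c = (if ∃ j < z, c = D.s j then 0 else w (c - 1)) +
      ∑ j ∈ Finset.range z, if c < D.s (j + 1) then w (D.s (j + 1) - 1) * D.b j c else 0 := by
  simp only [mulSparse, Counted.val_arr, if_pos hc, Counted.val_accumulate, ← Finset.sum_filter]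
  rfl

/-- The row `b j` contributes a multiplication and an addition to each of the first `s (j + 1)`
entries; the shift is free. -/
theorem cost_mulSparse (D : CharData K n) (z : ℕ) (w : ℕ → K) :
    (mulSparse D z w).cost ≤ 2 * D.sumS z := by
  rw [mulSparse, Counted.cost_arr]
  have h : ∀ c, ((List.range z).filter fun j => c < D.s (j + 1)).length =
      ∑ j ∈ Finset.range z, if c < D.s (j + 1) then 1 else 0 := fun c =>
    (Finset.card_filter (fun j => c < D.s (j + 1)) (Finset.range z) :)
  simp only [Counted.cost_accumulate, Counted.cost_mul, List.map_const', List.sum_replicate, h,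
    smul_eq_mul]
  rw [← Finset.sum_mul, Finset.sum_comm, mul_comm, sumS]
  gcongr with j hj
  rw [← Finset.card_filter]
  refine (Finset.card_le_card (t := Finset.range (D.s (j + 1))) fun c hc => ?_).trans_eq
    (Finset.card_range _)
  simpa using (Finset.mem_filter.1 hc).2

namespace Valid
variable {M : Matrix (Fin n) (Fin n) K} {D : CharData K n} (hD : D.Valid M)
include hD

/-- The coordinate vectors with respect to the rows of `Y` are multiplied by the sparse matrix
`Y M Y⁻¹`. -/
theorem comb_mulSparse {z : ℕ} (hz : z ≤ D.k) (w : ℕ → K) :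
    comb D.E.Y (D.s z) (mulSparse D z w).val = Matrix.vecMul (comb D.E.Y (D.s z) w) M := by
  have h₁ : comb D.E.Y (D.s z) (mulSparse D z w).val =
      ∑ c ∈ Finset.range (D.s z), (if ∃ j < z, c = D.s j then 0 else w (c - 1)) • D.E.Y c +
      ∑ j ∈ Finset.range z, w (D.s (j + 1) - 1) • comb D.E.Y (D.s (j + 1)) (D.b j) := by
    have h : ∀ j ∈ Finset.range z, w (D.s (j + 1) - 1) • comb D.E.Y (D.s (j + 1)) (D.b j) =
        ∑ c ∈ Finset.range (D.s z),
          (if c < D.s (j + 1) then w (D.s (j + 1) - 1) * D.b j c else 0) • D.E.Y c := by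
      intro j hj
      rw [← Finset.sum_subset (Finset.range_mono (D.s_mono (Finset.mem_range.1 hj))), comb,
        Finset.smul_sum]
      · exact Finset.sum_congr rfl fun i hi => by
          rw [if_pos (Finset.mem_range.1 hi), smul_smul]
      · intro i _ hi
        rw [if_neg (by simpa using hi), zero_smul]
    rw [Finset.sum_congr rfl h, Finset.sum_comm, ← Finset.sum_add_distrib, comb]
    refine Finset.sum_congr rfl fun c hc => ?_
    rw [val_mulSparse D z w (Finset.mem_range.1 hc), add_smul, Finset.sum_smul]
  rw [h₁, comb, D.sum_range_s, D.sum_range_s, ← Finset.sum_add_distrib, ← rowAct_X, map_sum]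
  refine Finset.sum_congr rfl fun i hi => ?_
  have hi := Finset.mem_range.1 hi
  have hik := hi.trans_le hz
  obtain ⟨e, he⟩ := Nat.exists_eq_succ_of_ne_zero (hD.pos i hik).ne'
  have hs : D.s (i + 1) = D.s i + (e + 1) := by rw [s_succ, he]
  have hY : ∀ c ≤ e, D.E.Y (D.s i + c) = rowAct M (X ^ c) (D.E.Y (D.s i)) := fun c hc =>
    hD.Y_eq i hik c (by omega)
  rw [he, Nat.succ_eq_add_one, Finset.sum_range_succ', if_pos ⟨i, hi, rfl⟩, zero_smul, add_zero,
    map_sum, Finset.sum_range_succ]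
  congr 1
  · refine Finset.sum_congr rfl fun c hc => ?_
    have hc := Finset.mem_range.1 hc
    rw [if_neg, map_smul, hY c (by omega), hY (c + 1) (by omega), pow_succ', rowAct_mul]
    · rfl
    · rintro ⟨j, -, hj⟩
      rcases le_or_gt j i with hji | hij
      · have := D.s_mono hji
        omega
      · have := D.s_mono (show i + 1 ≤ j from hij)
        omega
  · rw [← hD.b_eq i hik, he, map_smul, hY e le_rfl, pow_succ', rowAct_mul, hs]
    rfl

/-- The spans of the first `s z` rows are invariant under `M`. -/
theorem vecMul_mem {z : ℕ} (hz : z ≤ D.k) :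
    ∀ v ∈ rowSpan D.E.Y (D.s z), Matrix.vecMul v M ∈ rowSpan D.E.Y (D.s z) := by
  intro v hv
  obtain ⟨a, rfl⟩ := mem_rowSpan.1 hv
  rw [← hD.comb_mulSparse hz]
  exact comb_mem_rowSpan _ _ _

theorem s_le_len {z : ℕ} (hz : z ≤ D.k) : D.s z ≤ D.E.len :=
  hD.len_eq ▸ D.s_mono hz

/-- The part of a combination in block `i` is the image of the vector `v i` under a polynomial. -/
theorem comb_s_succ {i : ℕ} (hi : i < D.k) (v : ℕ → K) :
    comb D.E.Y (D.s (i + 1)) v = comb D.E.Y (D.s i) v +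
      rowAct M (∑ j ∈ Finset.range (D.p i).natDegree, monomial j (v (D.s i + j)))
        (D.E.Y (D.s i)) := by
  rw [s_succ, comb_add, map_sum, LinearMap.sum_apply, comb, comb]
  congr 1
  refine Finset.sum_congr rfl fun j hj => ?_
  rw [← C_mul_X_pow_eq_monomial, rowAct_C_mul, hD.Y_eq i hi j (Finset.mem_range.1 hj)]

/-- `p i` is the order polynomial of `v i` relative to the span of the preceding blocks. -/
theorem rowAct_mem_iff {i : ℕ} (hi : i < D.k) (f : K[X]) :
    rowAct M f (D.E.Y (D.s i)) ∈ rowSpan D.E.Y (D.s i) ↔ D.p i ∣ f := by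
  have hinv := hD.vecMul_mem hi.le
  constructor
  · intro hf
    have hdeg := natDegree_modByMonic_lt f (hD.monic i hi) (by
      intro h1
      have := hD.pos i hi
      simp [h1] at this)
    rw [← modByMonic_eq_zero_iff_dvd (hD.monic i hi)]
    set r := f %ₘ D.p i
    have hr : rowAct M r (D.E.Y (D.s i)) ∈ rowSpan D.E.Y (D.s i) := by
      rw [← modByMonic_add_div f (D.p i), map_add, LinearMap.add_apply, mul_comm, rowAct_mul] at hf
      exact (Submodule.add_mem_iff_left _ (rowAct_mem hinv _ (hD.p_mem i hi))).1 hf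
    have hsum : ∑ j ∈ Finset.range (D.p i).natDegree, monomial j (r.coeff (D.s i + j - D.s i)) =
        r := by
      simp only [Nat.add_sub_cancel_left]
      exact (as_sum_range' r _ hdeg).symm
    have hcomb := hD.comb_s_succ hi fun j => r.coeff (j - D.s i)
    rw [hsum] at hcomb
    have h := coeff_eq_zero_of_comb_mem_rowSpan hD.E_valid.indep (hD.s_le_len hi)
      (hcomb ▸ add_mem (comb_mem_rowSpan _ _ _) hr)
    ext c
    rw [coeff_zero]
    rcases lt_or_ge c (D.p i).natDegree with hc | hc
    · simpa using h (D.s i + c) (by rw [s_succ]; omega) (by omega)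
    · exact coeff_eq_zero_of_natDegree_lt (by omega)
  · rintro ⟨g, rfl⟩
    rw [mul_comm, rowAct_mul]
    exact rowAct_mem hinv g (hD.p_mem i hi)

theorem applyLoop_spec {z : ℕ} (hz : z ≤ D.k) (g : K[X]) (v : ℕ → K) (r : ℕ) :
    comb D.E.Y (D.s z) (applyLoop D z g v r).val.1 = rowAct M (X ^ r) (comb D.E.Y (D.s z) v) ∧
      comb D.E.Y (D.s z) (applyLoop D z g v r).val.2 =
        ∑ i ∈ Finset.range (r + 1), g.coeff i • rowAct M (X ^ i) (comb D.E.Y (D.s z) v) ∧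
      (applyLoop D z g v r).cost ≤ D.s z + r * (2 * D.sumS z + 2 * D.s z) := by
  have hs : ∀ (c : K) (w : ℕ → K) (y : ℕ → K), comb D.E.Y (D.s z)
      (fun j => if j < D.s z then y j + c * w j else 0) =
      comb D.E.Y (D.s z) y + c • comb D.E.Y (D.s z) w := by
    intro c w y
    rw [comb, comb, comb, Finset.smul_sum, ← Finset.sum_add_distrib]
    refine Finset.sum_congr rfl fun j hj => ?_
    rw [if_pos (Finset.mem_range.1 hj), add_smul, smul_smul]
  have h0 : comb D.E.Y (D.s z) (0 : ℕ → K) = 0 := by simp [comb]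
  induction r with
  | zero =>
    refine ⟨by simp [applyLoop], ?_, by simp [applyLoop]⟩
    have := hs (g.coeff 0) v 0
    simpa [applyLoop, h0] using this
  | succ r ih =>
    obtain ⟨h₁, h₂, h₃⟩ := ih
    have hw := hD.comb_mulSparse hz (applyLoop D z g v r).val.1
    rw [h₁, ← rowAct_X_pow_succ] at hw
    refine ⟨hw, ?_, ?_⟩
    · rw [Finset.sum_range_succ, ← h₂, ← hw, ← hs]
      rfl
    · have := cost_mulSparse D z (applyLoop D z g v r).val.1
      simp [applyLoop]
      linarith

theorem applyFactors_spec {z : ℕ} (hz : z ≤ D.k) {L : List K[X]}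
    (hL : ∀ g ∈ L, 0 < g.natDegree) (v : ℕ → K) :
    comb D.E.Y (D.s z) (applyFactors D z L v).val = rowAct M L.prod (comb D.E.Y (D.s z) v) ∧
      (applyFactors D z L v).cost ≤ (L.map natDegree).sum * (2 * D.sumS z + 3 * D.s z) := by
  induction L generalizing v with
  | nil => simp [applyFactors]
  | cons g L ih =>
    obtain ⟨hg, hL⟩ := List.forall_mem_cons.1 hL
    obtain ⟨-, h₂, h₃⟩ := hD.applyLoop_spec hz g v g.natDegree
    obtain ⟨g₁, g₂⟩ := ih hL (applyLoop D z g v g.natDegree).val.2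
    constructor
    · rw [List.prod_cons, mul_comm, rowAct_mul]
      have hval : (applyFactors D z (g :: L) v).val =
          (applyFactors D z L (applyLoop D z g v g.natDegree).val.2).val := rfl
      rw [hval, g₁, h₂]
      congr 1
      conv_rhs => rw [g.as_sum_range_C_mul_X_pow]
      simp only [map_sum, LinearMap.sum_apply, rowAct_C_mul]
    · simp only [applyFactors, Counted.cost_bind, List.map_cons, List.sum_cons, add_mul]
      nlinarith

end Valid

/-- An upper bound for the number of operations of OrdPoly. -/
def ordCost (D : CharData K n) (i : ℕ) : ℕ :=
  ∑ z ∈ Finset.range i,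
    (D.p z).natDegree * (2 * D.sumS (z + 1) + 3 * D.s (z + 1) + 2 * (D.p z).natDegree)

open Classical in
/-- OrdPoly returns the order polynomial of the vector with coordinates `v`. In the induction step,
the vector is mapped into the span of the smaller blocks precisely by the multiples of the product
of the recorded factors `G`, and the recursive call treats its image under that product. -/
theorem Valid.ordPoly_spec {M : Matrix (Fin n) (Fin n) K} {D : CharData K n} (hD : D.Valid M)
    {L : ℕ → List K[X]}
    (hL : ∀ i < D.k, (∀ g ∈ L i, g.Monic ∧ Irreducible g) ∧ (L i).prod = D.p i)
    {i : ℕ} (hi : i ≤ D.k) (v : ℕ → K) :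
    (∀ g ∈ (ordPoly D L i v).val, g.Monic ∧ Irreducible g) ∧
      (∀ f, rowAct M f (comb D.E.Y (D.s i) v) = 0 ↔ (ordPoly D L i v).val.prod ∣ f) ∧
      (ordPoly D L i v).cost ≤ D.ordCost i := by
  induction i generalizing v with
  | zero => simp [ordPoly, comb]
  | succ i ih =>
    have hik : i < D.k := hi
    have hinv := hD.vecMul_mem hik.le
    set h : K[X] := ∑ j ∈ Finset.range (D.p i).natDegree, monomial j (v (D.s i + j)) with hh
    have hx := hD.comb_s_succ hik v
    rw [← hh] at hx
    have hmem : ∀ f, rowAct M f (comb D.E.Y (D.s (i + 1)) v) ∈ rowSpan D.E.Y (D.s i) ↔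
        D.p i ∣ f * h := by
      intro f
      rw [hx, map_add, ← rowAct_mul, Submodule.add_mem_iff_right, hD.rowAct_mem_iff hik]
      exact rowAct_mem hinv f (comb_mem_rowSpan _ _ _)
    have hoc : D.ordCost (i + 1) = D.ordCost i + (D.p i).natDegree *
        (2 * D.sumS (i + 1) + 3 * D.s (i + 1) + 2 * (D.p i).natDegree) :=
      Finset.sum_range_succ _ _
    by_cases h0 : h ≠ 0
    · have hprod := (hL i hik).2
      obtain ⟨c₁, c₂, c₃, c₄⟩ := cofactors_dedup_spec (hL i hik).1 h0 (by
        rw [hprod]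
        exact natDegree_sum_monomial_lt (hD.pos i hik) _)
      rw [hprod] at c₂ c₃ c₄
      set G := cofactors (L i) h (L i).dedup
      set v' : Counted (ℕ → K) := if 0 < i then applyFactors D (i + 1) G.val v else pure v with hv'
      have hG0 : G.val.prod ≠ 0 := List.prod_ne_zero fun h => (c₁ 0 h).2.ne_zero rfl
      obtain ⟨a₁, a₂⟩ := hD.applyFactors_spec hi (fun g hg => (c₁ g hg).2.natDegree_pos) v
      have hGx : rowAct M G.val.prod (comb D.E.Y (D.s (i + 1)) v) ∈ rowSpan D.E.Y (D.s i) :=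
        (hmem _).2 ((c₃ _).2 dvd_rfl)
      -- For `i = 0` the program skips this image, which is zero.
      have hcomb : comb D.E.Y (D.s i) v'.val =
          rowAct M G.val.prod (comb D.E.Y (D.s (i + 1)) v) := by
        rcases Nat.eq_zero_or_pos i with rfl | hi0
        · obtain ⟨a, ha⟩ := mem_rowSpan.1 hGx
          rw [← ha]
          simp [comb]
        · rw [hv', if_pos hi0, ← a₁, s_succ, comb_add, left_eq_add]
          rw [← a₁] at hGx
          have := coeff_eq_zero_of_comb_mem_rowSpan hD.E_valid.indep (hD.s_le_len hi) hGx
          exact Finset.sum_eq_zero fun j hj => by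
            have hj := Finset.mem_range.1 hj
            change (applyFactors D (i + 1) G.val v).val (D.s i + j) • _ = _
            rw [this _ (by rw [s_succ]; omega) (by omega), zero_smul]
      have hcost : v'.cost ≤ (D.p i).natDegree * (2 * D.sumS (i + 1) + 3 * D.s (i + 1)) := by
        rw [hv', Counted.cost_ite]
        split_ifs
        · exact a₂.trans (Nat.mul_le_mul_right _ c₂)
        · simp
      obtain ⟨g₁, g₂, g₃⟩ := ih hik.le v'.val
      obtain ⟨hval, hcost'⟩ : (ordPoly D L (i + 1) v).val =
            G.val ++ (ordPoly D L i v'.val).val ∧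
          (ordPoly D L (i + 1) v).cost = G.cost + (v'.cost + (ordPoly D L i v'.val).cost) := by
        have hdef : ordPoly D L (i + 1) v = _ := if_pos h0
        rw [hdef, hv']
        split_ifs <;> exact ⟨rfl, rfl⟩
      rw [hval, hcost']
      refine ⟨?_, fun f => ?_, ?_⟩
      · intro g hg
        rcases List.mem_append.1 hg with hg | hg
        · exact c₁ g hg
        · exact g₁ g hg
      · have hcancel : ∀ f₁, rowAct M (G.val.prod * f₁) (comb D.E.Y (D.s (i + 1)) v) = 0 ↔
            G.val.prod * (ordPoly D L i v'.val).val.prod ∣ G.val.prod * f₁ := fun f₁ => by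
          rw [mul_dvd_mul_iff_left hG0, ← g₂, hcomb, mul_comm, rowAct_mul]
        rw [List.prod_append]
        constructor
        · intro hf
          obtain ⟨f₁, rfl⟩ := (c₃ f).1 ((hmem f).1 (hf ▸ zero_mem _))
          exact (hcancel f₁).1 hf
        · intro hf
          obtain ⟨f₁, rfl⟩ := dvd_of_mul_right_dvd hf
          exact (hcancel f₁).2 hf
      · rw [hoc]
        nlinarith
    · have hval : ordPoly D L (i + 1) v = ordPoly D L i v := if_neg h0
      rw [hval]
      obtain ⟨g₁, g₂, g₃⟩ := ih hik.le v
      rw [not_not] at h0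
      rw [hx, h0]
      simp only [map_zero, LinearMap.zero_apply, add_zero]
      exact ⟨g₁, g₂, by omega⟩

/-- Summation by parts turns the leading term into `2 * ∑ z < i, s (z + 1) * (s i - s z)`, and
`x * (s i - x) ≤ s i ^ 2 / 4`. -/
theorem ordCost_le (D : CharData K n) (i : ℕ) :
    (D.ordCost i : ℝ) ≤ ((i : ℝ) / 2 + 7) * (D.s i : ℝ) ^ 2 := by
  have hparts : ∑ z ∈ Finset.range i, (D.p z).natDegree * D.sumS (z + 1) +
      ∑ z ∈ Finset.range i, D.s z * D.s (z + 1) = D.s i * D.sumS i := by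
    induction i with
    | zero => simp
    | succ i ih =>
      have h : D.sumS (i + 1) = D.sumS i + D.s (i + 1) := Finset.sum_range_succ _ _
      rw [Finset.sum_range_succ, Finset.sum_range_succ, h, D.s_succ i]
      linear_combination ih
  have hd : ∑ z ∈ Finset.range i, ((D.p z).natDegree : ℝ) = D.s i := by
    rw [CharData.s]; push_cast; rfl
  have hA : (D.sumS i : ℝ) = ∑ z ∈ Finset.range i, (D.s (z + 1) : ℝ) := by
    rw [sumS]; push_cast; rfl
  have hquad : ∑ z ∈ Finset.range i, 2 * (D.s (z + 1) : ℝ) * (D.s i - D.s z) ≤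
      ∑ z ∈ Finset.range i, ((D.s i : ℝ) ^ 2 / 2 + 2 * D.s i * (D.p z).natDegree) := by
    refine Finset.sum_le_sum fun z hz => ?_
    have h₁ : (D.s (z + 1) : ℝ) = D.s z + (D.p z).natDegree := by
      rw [s_succ]; push_cast; rfl
    have h₂ : (D.s (z + 1) : ℝ) ≤ D.s i := by exact_mod_cast D.s_mono (Finset.mem_range.1 hz)
    have h₃ : (0 : ℝ) ≤ (D.p z).natDegree := Nat.cast_nonneg _
    nlinarith [sq_nonneg ((D.s i : ℝ) - 2 * D.s (z + 1)), mul_le_mul_of_nonneg_right h₂ h₃]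
  have hrest : ∑ z ∈ Finset.range i, ((D.p z).natDegree : ℝ) *
      (3 * D.s (z + 1) + 2 * (D.p z).natDegree) ≤
      ∑ z ∈ Finset.range i, ((D.p z).natDegree : ℝ) * (5 * D.s i) := by
    refine Finset.sum_le_sum fun z hz => ?_
    have h₁ : D.s (z + 1) = D.s z + (D.p z).natDegree := D.s_succ z
    have h₂ : D.s (z + 1) ≤ D.s i := D.s_mono (Finset.mem_range.1 hz)
    gcongr
    exact_mod_cast (by omega : 3 * D.s (z + 1) + 2 * (D.p z).natDegree ≤ 5 * D.s i)
  have htotal : (D.ordCost i : ℝ) =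
      2 * (∑ z ∈ Finset.range i, (D.p z).natDegree * D.sumS (z + 1) : ℕ) +
        ∑ z ∈ Finset.range i, ((D.p z).natDegree : ℝ) *
          (3 * D.s (z + 1) + 2 * (D.p z).natDegree) := by
    rw [ordCost]
    push_cast
    rw [Finset.mul_sum, ← Finset.sum_add_distrib]
    exact Finset.sum_congr rfl fun z _ => by ring
  have hlead : 2 * ((∑ z ∈ Finset.range i, (D.p z).natDegree * D.sumS (z + 1) : ℕ) : ℝ) =
      ∑ z ∈ Finset.range i, 2 * (D.s (z + 1) : ℝ) * (D.s i - D.s z) := by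
    have h := congrArg (Nat.cast : ℕ → ℝ) hparts
    rw [Nat.cast_add, Nat.cast_mul, hA] at h
    rw [eq_sub_of_add_eq h]
    push_cast
    rw [mul_sub, Finset.mul_sum, Finset.mul_sum, Finset.mul_sum, ← Finset.sum_sub_distrib]
    exact Finset.sum_congr rfl fun z _ => by ring
  rw [Finset.sum_add_distrib, ← Finset.mul_sum, hd, Finset.sum_const, Finset.card_range,
    nsmul_eq_mul] at hquad
  rw [← Finset.sum_mul, hd] at hrest
  rw [htotal, hlead]
  nlinarith

end CharData

/-! ### The irreducible factors of the minimal polynomial -/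

/-- A root of `g` in `K[X] / (g)` is an eigenvalue of `M`, hence a root of the minimal polynomial. -/
theorem Matrix.dvd_minpoly_of_dvd_charpoly (M : Matrix (Fin n) (Fin n) K) {g : K[X]}
    (hg : Irreducible g) (h : g ∣ M.charpoly) : g ∣ minpoly K M := by
  have : Fact (Irreducible g) := ⟨hg⟩
  let φ := (Algebra.ofId K (AdjoinRoot g)).mapMatrix (m := Fin n)
  have hφ : φ M = M.map (algebraMap K (AdjoinRoot g)) := rfl
  have hroot : (φ M).charpoly.IsRoot (AdjoinRoot.root g) := by
    rw [hφ, Matrix.charpoly_map, IsRoot, eval_map_algebraMap]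
    exact aeval_eq_zero_of_dvd_aeval_eq_zero h (by simp [AdjoinRoot.aeval_eq])
  have hspec := spectrum.subset_polynomial_aeval (φ M)
    ((minpoly K M).map (algebraMap K (AdjoinRoot g)))
    ⟨_, Matrix.mem_spectrum_of_isRoot_charpoly hroot, rfl⟩
  rw [aeval_map_algebraMap, aeval_algHom_apply, minpoly.aeval, map_zero] at hspec
  by_contra hnd
  refine hspec ?_
  simp only [eval_map_algebraMap, AdjoinRoot.aeval_eq]
  rw [spectrum.mem_resolventSet_iff, sub_zero]
  exact ((isUnit_iff_ne_zero.2 fun h0 => hnd (AdjoinRoot.mk_eq_zero.1 h0))).map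
    (algebraMap (AdjoinRoot g) (Matrix (Fin n) (Fin n) (AdjoinRoot g)))

theorem mem_irreducibleFactors {p g : K[X]} (hp : p ≠ 0) :
    g ∈ irreducibleFactors p ↔ Irreducible g ∧ g.Monic ∧ g ∣ p := by
  classical
  rw [irreducibleFactors, Multiset.mem_toFinset, Polynomial.mem_normalizedFactors_iff hp]

theorem Matrix.mem_irreducibleFactors_charpoly {M : Matrix (Fin n) (Fin n) K} {g : K[X]} :
    g ∈ irreducibleFactors M.charpoly ↔ Irreducible g ∧ g.Monic ∧ g ∣ minpoly K M := by
  rw [mem_irreducibleFactors M.charpoly_monic.ne_zero]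
  exact ⟨fun h => ⟨h.1, h.2.1, M.dvd_minpoly_of_dvd_charpoly h.1 h.2.2⟩,
    fun h => ⟨h.1, h.2.1, h.2.2.trans M.minpoly_dvd_charpoly⟩⟩

open Classical in
/-- A multiset of monic irreducible polynomials divides `p` if and only if it is contained in the
factorisation of `p`. -/
theorem prod_dvd_iff_le_normalizedFactors {m : Multiset K[X]}
    (hm : ∀ g ∈ m, g.Monic ∧ Irreducible g) {p : K[X]} (hp : p ≠ 0) :
    m.prod ∣ p ↔ m ≤ UniqueFactorizationMonoid.normalizedFactors p := by
  have h0 : m.prod ≠ 0 := Multiset.prod_ne_zero fun h => (hm 0 h).2.ne_zero rfl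
  rw [UniqueFactorizationMonoid.dvd_iff_normalizedFactors_le_normalizedFactors h0 hp,
    UniqueFactorizationMonoid.normalizedFactors_prod_eq m fun g hg => (hm g hg).2,
    Multiset.map_congr rfl fun g hg => (hm g hg).1.normalize_eq_self, Multiset.map_id']

namespace CharData.Valid
variable {M : Matrix (Fin n) (Fin n) K} {D : CharData K n} (hD : D.Valid M)
include hD

theorem p_dvd_minpoly {i : ℕ} (hi : i < D.k) : D.p i ∣ minpoly K M := by
  rw [← hD.rowAct_mem_iff hi, (minpoly_dvd_iff_rowAct M _).1 dvd_rfl]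
  exact zero_mem _

/-- The product of the relative order polynomials moves a vector down the flag of invariant subspaces
to zero. -/
theorem prod_p_rowAct {i : ℕ} (hi : i ≤ D.k) {v : Fin n → K} (hv : v ∈ rowSpan D.E.Y (D.s i)) :
    rowAct M (∏ j ∈ Finset.range i, D.p j) v = 0 := by
  induction i generalizing v with
  | zero =>
    obtain ⟨a, rfl⟩ := mem_rowSpan.1 hv
    simp [comb]
  | succ i ih =>
    obtain ⟨a, rfl⟩ := mem_rowSpan.1 hv
    rw [Finset.prod_range_succ, rowAct_mul]
    refine ih (Nat.le_of_succ_le hi) ?_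
    rw [hD.comb_s_succ hi, map_add, ← rowAct_mul]
    refine add_mem (rowAct_mem (hD.vecMul_mem (Nat.le_of_succ_le hi)) _ (comb_mem_rowSpan _ _ _)) ?_
    exact (hD.rowAct_mem_iff hi _).2 (dvd_mul_right _ _)

theorem rowSpan_eq_top (hn : D.E.len = n) : rowSpan D.E.Y n = ⊤ := by
  refine Submodule.eq_top_of_finrank_eq ?_
  have := hD.E_valid.finrank_rowSpan
  rw [hn] at this
  rw [this, Module.finrank_fin_fun]

theorem minpoly_dvd_prod_p (hn : D.E.len = n) :
    minpoly K M ∣ ∏ j ∈ Finset.range D.k, D.p j := by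
  rw [minpoly_dvd_iff_rowAct]
  intro v
  refine hD.prod_p_rowAct le_rfl ?_
  rw [← hD.len_eq, hn, hD.rowSpan_eq_top hn]
  trivial

/-- The vectors chosen by CharPoly generate the whole space. -/
theorem minpoly_dvd_of_forall (hn : D.E.len = n) {f : K[X]}
    (hf : ∀ i < D.k, rowAct M f (D.E.Y (D.s i)) = 0) : minpoly K M ∣ f := by
  have hker : ∀ i ≤ D.k, ∀ v ∈ rowSpan D.E.Y (D.s i), rowAct M f v = 0 := by
    intro i
    induction i with
    | zero =>
      intro _ v hv
      obtain ⟨a, rfl⟩ := mem_rowSpan.1 hv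
      simp [comb]
    | succ i ih =>
      intro hi v hv
      obtain ⟨a, rfl⟩ := mem_rowSpan.1 hv
      rw [hD.comb_s_succ hi, map_add, ih (Nat.le_of_succ_le hi) _ (comb_mem_rowSpan _ _ _),
        rowAct_comm, hf i hi, map_zero, add_zero]
  rw [minpoly_dvd_iff_rowAct]
  intro v
  refine hker D.k le_rfl v ?_
  rw [← hD.len_eq, hn, hD.rowSpan_eq_top hn]
  trivial

/-- The standard basis vector with index `s i` is the coordinate vector of `v i`. -/
theorem ordPoly_single_spec {L : ℕ → List K[X]}
    (hL : ∀ i < D.k, (∀ g ∈ L i, g.Monic ∧ Irreducible g) ∧ (L i).prod = D.p i)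
    {i : ℕ} (hi : i < D.k) :
    (∀ g ∈ (ordPoly D L (i + 1) (Pi.single (D.s i) 1)).val, g.Monic ∧ Irreducible g) ∧
      (∀ f, rowAct M f (D.E.Y (D.s i)) = 0 ↔
        (ordPoly D L (i + 1) (Pi.single (D.s i) 1)).val.prod ∣ f) ∧
      (ordPoly D L (i + 1) (Pi.single (D.s i) 1)).cost ≤ D.ordCost (i + 1) := by
  have h : comb D.E.Y (D.s (i + 1)) (Pi.single (D.s i) 1) = D.E.Y (D.s i) := by
    have hlt : D.s i < D.s (i + 1) := by rw [s_succ]; have := hD.pos i hi; omega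
    rw [comb, Finset.sum_eq_single (D.s i)]
    · simp
    · intro j _ hj
      simp [hj]
    · simp [hlt]
  have := hD.ordPoly_spec hL (Nat.succ_le_of_lt hi) (Pi.single (D.s i) 1)
  rwa [h] at this

end CharData.Valid

/-! ### Factorisation and least common multiples -/

theorem factoriseAll_spec (F : Factoriser K) {p : ℕ → K[X]} {k : ℕ} (hp : ∀ j < k, (p j).Monic)
    {r : (ℕ → List K[X]) × Tally} (hr : r ∈ (factoriseAll F p k).law.support) :
    (∀ j < k, (∀ g ∈ r.1 j, g.Monic ∧ Irreducible g) ∧ (r.1 j).prod = p j) ∧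
      r.2.draws = [] := by
  induction k generalizing r with
  | zero => simp [Prog.mem_support_pure.1 hr]
  | succ k ih =>
    obtain ⟨L, hL, t, ht, rfl⟩ := Prog.mem_support_bind.1 hr
    obtain ⟨g, hg, u, hu, rfl⟩ := Prog.mem_support_bind.1 ht
    obtain rfl := Prog.mem_support_pure.1 hu
    obtain ⟨g, hg', rfl⟩ := (PMF.mem_support_map_iff _ _ _).1 hg
    obtain ⟨h₁, h₂⟩ := ih (fun j hj => hp j (by omega)) hL
    refine ⟨fun j hj => ?_, by simp [h₂]⟩
    rcases Nat.lt_succ_iff_lt_or_eq.1 hj with hj | rfl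
    · simp only [Function.update_of_ne hj.ne]
      exact h₁ j hj
    · simp only [Function.update_self]
      exact F.correct _ (hp j (by omega)) _ hg'

open Classical in
theorem lcmLoop_le_iff (D : CharData K n) (L : ℕ → List K[X]) (is : List ℕ) (f m : Multiset K[X]) :
    (lcmLoop D L is f).val ≤ m ↔ f ≤ m ∧
      ∀ i ∈ is, ((ordPoly D L i (Pi.single (D.s (i - 1)) 1)).val : Multiset K[X]) ≤ m := by
  induction is generalizing f with
  | nil => simp [lcmLoop]
  | cons i is ih =>
    have h : (lcmLoop D L (i :: is) f).val = (lcmLoop D L is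
      (f ∪ ((ordPoly D L i (Pi.single (D.s (i - 1)) 1)).val : Multiset K[X]))).val := rfl
    rw [h, ih, ← Multiset.sup_eq_union, sup_le_iff, List.forall_mem_cons, and_assoc]

theorem mem_lcmLoop {D : CharData K n} {L : ℕ → List K[X]} {is : List ℕ} {f : Multiset K[X]}
    {g : K[X]} (hg : g ∈ (lcmLoop D L is f).val) :
    g ∈ f ∨ ∃ i ∈ is, g ∈ (ordPoly D L i (Pi.single (D.s (i - 1)) 1)).val := by
  classical
  induction is generalizing f with
  | nil => exact Or.inl hg
  | cons i is ih =>
    rcases ih hg with h | ⟨j, hj, h⟩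
    · rcases Multiset.mem_union.1 h with h | h
      · exact Or.inl h
      · exact Or.inr ⟨i, by simp, h⟩
    · exact Or.inr ⟨j, by simp [hj], h⟩

theorem cost_lcmLoop (D : CharData K n) (L : ℕ → List K[X]) (is : List ℕ) (f : Multiset K[X]) :
    (lcmLoop D L is f).cost =
      (is.map fun i => (ordPoly D L i (Pi.single (D.s (i - 1)) 1)).cost).sum := by
  induction is generalizing f with
  | nil => rfl
  | cons i is ih => simp [lcmLoop, ih]

/-! ### MinPolyMC after CharPoly -/

open Classical in
/-- The number `u₀` of vectors that suffice for the error probability `ε`. -/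
noncomputable def roundBound [Fintype K] (M : Matrix (Fin n) (Fin n) K) (ε : ℝ) : ℕ :=
  sInf {u : ℕ | ∑ g ∈ irreducibleFactors M.charpoly,
    ((Fintype.card K : ℝ) ^ (u * g.natDegree))⁻¹ ≤ ε}

open Classical in
/-- The part of MinPolyMC after the call of CharPoly. -/
noncomputable def afterCharPoly [Fintype K] (F : Factoriser K) (ε : ℝ) (D : CharData K n) :
    Prog (MinPolyResult K) := do
  let L ← factoriseAll F D.p D.k
  let Q : Finset K[X] := (Finset.range D.k).biUnion fun j => (L j).toFinset
  let u₀ : ℕ := sInf {u : ℕ | ∑ g ∈ Q, ((Fintype.card K : ℝ) ^ (u * g.natDegree))⁻¹ ≤ ε}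
  let u : ℕ := min u₀ D.k
  let f₀ : Multiset K[X] := (Finset.range D.k).sup fun j => (L j : Multiset K[X])
  let f ← Prog.det (lcmLoop D L (List.range' 2 (u - 1)) f₀)
  pure
    { verdict := if u = D.k ∨ (f.map natDegree).sum = n then .certain else .uncertain
      factors := f
      k := D.k
      u := u
      s := D.s }

theorem minPolyMC_eq_bind [Fintype K] (F : Factoriser K) (M : Matrix (Fin n) (Fin n) K) (ε : ℝ) :
    minPolyMC F M ε = charPoly M >>= afterCharPoly F ε := rfl

namespace CharData.Valid
variable {M : Matrix (Fin n) (Fin n) K} {D : CharData K n} (hD : D.Valid M) (hn : D.E.len = n)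
  {L : ℕ → List K[X]}
  (hL : ∀ i < D.k, (∀ g ∈ L i, g.Monic ∧ Irreducible g) ∧ (L i).prod = D.p i)
include hD

include hn in
theorem exists_dvd_p {g : K[X]} (hg : Irreducible g) (h : g ∣ minpoly K M) :
    ∃ j < D.k, g ∣ D.p j := by
  obtain ⟨j, hj, hgj⟩ := (hg.prime.dvd_finsetProd_iff _).1 (h.trans (hD.minpoly_dvd_prod_p hn))
  exact ⟨j, Finset.mem_range.1 hj, hgj⟩

include hL

include hn in
open Classical in
/-- The irreducible factors found in the factorisation step are those of the characteristic polynomial. -/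
theorem biUnion_factors_eq : (Finset.range D.k).biUnion (fun j => (L j).toFinset) =
    irreducibleFactors M.charpoly := by
  ext g
  simp only [Finset.mem_biUnion, Finset.mem_range, List.mem_toFinset,
    Matrix.mem_irreducibleFactors_charpoly]
  constructor
  · rintro ⟨j, hj, hg⟩
    obtain ⟨h₁, h₂⟩ := (hL j hj).1 g hg
    exact ⟨h₂, h₁, ((hL j hj).2 ▸ List.dvd_prod hg).trans (hD.p_dvd_minpoly hj)⟩
  · rintro ⟨h₁, h₂, h₃⟩
    obtain ⟨j, hj, hgj⟩ := hD.exists_dvd_p hn h₁ h₃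
    rw [← (hL j hj).2, h₁.prime.dvd_prod_iff] at hgj
    obtain ⟨a, ha, hga⟩ := hgj
    obtain ⟨ha₁, ha₂⟩ := (hL j hj).1 a ha
    rw [eq_of_monic_of_associated h₂ ha₁ (h₁.associated_of_dvd ha₂ hga)]
    exact ⟨j, hj, ha⟩

omit hD hL in
open Classical in
theorem sup_factors_le_iff {m : Multiset K[X]} :
    (Finset.range D.k).sup (fun j => (L j : Multiset K[X])) ≤ m ↔
      ∀ j < D.k, (L j : Multiset K[X]) ≤ m := by
  simp

open Classical in
/-- The least common multiple annihilates the first `u` vectors. The loop starts with the second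
vector, since the order polynomial of the first one is `p 0`. -/
theorem lcmLoop_spec {u : ℕ} (hu : u ≤ D.k) {f : Multiset K[X]}
    (hf : f = (lcmLoop D L (List.range' 2 (u - 1))
      ((Finset.range D.k).sup fun j => (L j : Multiset K[X]))).val) :
    (∀ g ∈ f, g.Monic ∧ Irreducible g) ∧ f.prod ∣ minpoly K M ∧ (∀ j < D.k, D.p j ∣ f.prod) ∧
      ∀ i < u, rowAct M f.prod (D.E.Y (D.s i)) = 0 := by
  have hrange : ∀ i ∈ List.range' 2 (u - 1), ∃ j < u, i = j + 1 := fun i hi => by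
    rw [List.mem_range'_1] at hi
    exact ⟨i - 1, by omega, by omega⟩
  have hirr : ∀ g ∈ f, g.Monic ∧ Irreducible g := by
    intro g hg
    rcases mem_lcmLoop (hf ▸ hg) with h | ⟨i, hi, h⟩
    · have hle : (Finset.range D.k).sup (fun j => (L j : Multiset K[X])) ≤
          ∑ j ∈ Finset.range D.k, (L j : Multiset K[X]) :=
        Finset.sup_le fun j hj => Finset.single_le_sum (f := fun j => (L j : Multiset K[X]))
          (fun _ _ => zero_le) hj
      obtain ⟨j, hj, h⟩ := Multiset.mem_sum.1 (Multiset.mem_of_le hle h)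
      exact (hL j (Finset.mem_range.1 hj)).1 g h
    · obtain ⟨i, hiu, rfl⟩ := hrange i hi
      exact (hD.ordPoly_single_spec hL (hiu.trans_le hu)).1 g h
  have hp : ∀ j < D.k, D.p j ∣ f.prod := by
    have h := (sup_factors_le_iff).1 ((lcmLoop_le_iff D L _ _ f).1 hf.ge).1
    intro j hj
    rw [← (hL j hj).2, ← Multiset.prod_coe]
    exact Multiset.prod_dvd_prod_of_le (h j hj)
  refine ⟨hirr, ?_, hp, fun i hi => ?_⟩
  · have h0 : minpoly K M ≠ 0 := minpoly.ne_zero (Matrix.isIntegral M)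
    rw [prod_dvd_iff_le_normalizedFactors hirr h0]
    nth_rw 1 [hf]
    rw [lcmLoop_le_iff, sup_factors_le_iff]
    refine ⟨fun j hj => ?_, fun i hi => ?_⟩
    · rw [← prod_dvd_iff_le_normalizedFactors (hL j hj).1 h0, Multiset.prod_coe, (hL j hj).2]
      exact hD.p_dvd_minpoly hj
    · obtain ⟨i, hiu, rfl⟩ := hrange i hi
      obtain ⟨h₁, h₂, -⟩ := hD.ordPoly_single_spec hL (hiu.trans_le hu)
      rw [Nat.add_sub_cancel, ← prod_dvd_iff_le_normalizedFactors h₁ h0, Multiset.prod_coe, ← h₂]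
      exact (minpoly_dvd_iff_rowAct M _).1 dvd_rfl _
  · rcases Nat.eq_zero_or_pos i with rfl | hpos
    · obtain ⟨c, hc⟩ := hp 0 (by omega)
      obtain ⟨a, ha⟩ := mem_rowSpan.1 (hD.p_mem 0 (by omega))
      rw [hc, mul_comm, rowAct_mul, ← ha]
      simp [comb]
    · have h := ((lcmLoop_le_iff D L _ _ f).1 hf.ge).2 (i + 1)
        (by rw [List.mem_range'_1]; omega)
      rw [(hD.ordPoly_single_spec hL (hi.trans_le hu)).2.1, ← Multiset.prod_coe]
      exact Multiset.prod_dvd_prod_of_le h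

theorem cost_lcmLoop_le {u : ℕ} (hu : u ≤ D.k) (f : Multiset K[X]) :
    ((lcmLoop D L (List.range' 2 (u - 1)) f).cost : ℝ) ≤
      ∑ i ∈ Finset.Icc 1 u, ((i : ℝ) / 2 + 9) * (D.s i : ℝ) ^ 2 := by
  rw [cost_lcmLoop, ← List.sum_toFinset _ List.nodup_range', List.toFinset_range'_1,
    Nat.cast_sum]
  refine (Finset.sum_le_sum fun i hi => ?_).trans
    (Finset.sum_le_sum_of_subset_of_nonneg (fun i hi => ?_) fun i _ _ => by positivity)
  · rw [Finset.mem_Ico] at hi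
    obtain ⟨j, rfl⟩ : ∃ j, i = j + 1 := ⟨i - 1, by omega⟩
    have h := (hD.ordPoly_single_spec hL (i := j) (by omega)).2.2
    refine (Nat.cast_le.2 h).trans ((D.ordCost_le (j + 1)).trans ?_)
    gcongr
    norm_num
  · rw [Finset.mem_Ico] at hi
    rw [Finset.mem_Icc]
    omega

end CharData.Valid

/-- A proper divisor of the minimal polynomial divides a maximal proper divisor. -/
theorem exists_irreducibleFactor_of_ne {M : Matrix (Fin n) (Fin n) K} {f : K[X]} (hf : f.Monic)
    (hdvd : f ∣ minpoly K M) (hne : f ≠ minpoly K M) :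
    ∃ q ∈ irreducibleFactors M.charpoly, f ∣ minpoly K M /ₘ q := by
  have hmon : (minpoly K M).Monic := minpoly.monic (Matrix.isIntegral M)
  obtain ⟨c, hc⟩ := hdvd
  have hcm : c.Monic := hf.of_mul_monic_left (hc ▸ hmon)
  have hcu : ¬ IsUnit c := fun h => hne (by rw [hc, hcm.eq_one_of_isUnit h, mul_one])
  obtain ⟨q, hqm, hqi, e, rfl⟩ := Polynomial.exists_monic_irreducible_factor c hcu
  refine ⟨q, Matrix.mem_irreducibleFactors_charpoly.2 ⟨hqi, hqm, ?_⟩, ?_⟩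
  · exact ⟨f * e, by rw [hc]; ring⟩
  · rw [hc, mul_left_comm, mul_divByMonic_cancel_left _ hqm]
    exact dvd_mul_right _ _

/-- The quotient of the minimal polynomial by an irreducible factor does not annihilate the whole
space. -/
theorem not_minpoly_dvd_divByMonic {M : Matrix (Fin n) (Fin n) K} {q : K[X]}
    (hq : q ∈ irreducibleFactors M.charpoly) : ¬ minpoly K M ∣ minpoly K M /ₘ q := by
  obtain ⟨hqi, hqm, e, he⟩ := Matrix.mem_irreducibleFactors_charpoly.1 hq
  have h0 : minpoly K M ≠ 0 := minpoly.ne_zero (Matrix.isIntegral M)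
  have he0 : e ≠ 0 := by rintro rfl; exact h0 (by rw [he, mul_zero])
  rw [he, mul_divByMonic_cancel_left _ hqm]
  intro h
  have := natDegree_le_of_dvd h he0
  rw [natDegree_mul hqi.ne_zero he0] at this
  have := hqi.natDegree_pos
  omega

/-- What the part of MinPolyMC after CharPoly guarantees. If the result `f` is not the minimal
polynomial, then for some irreducible factor `q` the vectors used lie in the kernel of the quotient
of the minimal polynomial by `q`. -/
theorem afterCharPoly_spec [Fintype K] (F : Factoriser K) (ε : ℝ) {M : Matrix (Fin n) (Fin n) K}
    {D : CharData K n} (hD : D.Valid M) (hn : D.E.len = n) {r : MinPolyResult K × Tally}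
    (hr : r ∈ (afterCharPoly F ε D).law.support) :
    r.1.k = D.k ∧ r.1.s = D.s ∧ r.1.u = min (roundBound M ε) D.k ∧ r.2.draws = [] ∧
      r.1.f.Monic ∧ r.1.f ∣ minpoly K M ∧
      (∀ g : K[X], Irreducible g → g ∣ minpoly K M → g ∣ r.1.f) ∧
      (r.1.f ≠ minpoly K M → r.1.u < D.k ∧ ∃ q ∈ irreducibleFactors M.charpoly,
        ∀ i < r.1.u, rowAct M (minpoly K M /ₘ q) (D.E.Y (D.s i)) = 0) ∧
      (r.1.verdict = Verdict.certain → r.1.f = minpoly K M) ∧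
      ∀ factB, IsFactBound F n factB → (r.2.ops : ℝ) ≤ factB +
        ∑ i ∈ Finset.Icc 1 r.1.u, ((i : ℝ) / 2 + 9) * (r.1.s i : ℝ) ^ 2 := by
  classical
  obtain ⟨L, hL', r₁, hr₁, rfl⟩ := Prog.mem_support_bind.1 hr
  obtain ⟨hL, hdraws⟩ := factoriseAll_spec F hD.monic hL'
  simp only [hD.biUnion_factors_eq hn hL] at hr₁
  obtain ⟨f, hf, r₂, hr₂, rfl⟩ := Prog.mem_support_bind.1 hr₁
  obtain rfl := Prog.mem_support_pure.1 hr₂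
  obtain rfl := Prog.mem_support_det.1 hf
  set u := min (roundBound M ε) D.k with hu
  obtain ⟨h₁, h₂, h₃, h₄⟩ := hD.lcmLoop_spec hL (min_le_right _ _ : u ≤ D.k) rfl
  have hcost := hD.cost_lcmLoop_le hL (min_le_right _ _ : u ≤ D.k)
    ((Finset.range D.k).sup fun j => (L.1 j : Multiset K[X]))
  set f : Multiset K[X] := (lcmLoop D L.1 (List.range' 2 (u - 1))
    ((Finset.range D.k).sup fun j => (L.1 j : Multiset K[X]))).val with hf
  have hfm : f.prod.Monic := by
    simpa using monic_multiset_prod_of_monic f id fun g hg => (h₁ g hg).1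
  have hfail : f.prod ≠ minpoly K M → u < D.k ∧ ∃ q ∈ irreducibleFactors M.charpoly,
      ∀ i < u, rowAct M (minpoly K M /ₘ q) (D.E.Y (D.s i)) = 0 := by
    intro hne
    obtain ⟨q, hq, e, he⟩ := exists_irreducibleFactor_of_ne hfm h₂ hne
    have hker : ∀ i < u, rowAct M (minpoly K M /ₘ q) (D.E.Y (D.s i)) = 0 := fun i hi => by
      rw [he, mul_comm, rowAct_mul, h₄ i hi, map_zero]
    refine ⟨lt_of_le_of_ne (min_le_right _ _) fun huk => ?_, q, hq, hker⟩
    exact not_minpoly_dvd_divByMonic hq (hD.minpoly_dvd_of_forall hn fun i hi =>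
      hker i (huk.symm ▸ hi))
  refine ⟨rfl, rfl, rfl, by simp [hdraws], hfm, h₂, fun g hg hgM => ?_, hfail, fun hv => ?_,
    fun factB hB => ?_⟩
  · obtain ⟨j, hj, hgj⟩ := hD.exists_dvd_p hn hg hgM
    exact hgj.trans (h₃ j hj)
  · have hcert : u = D.k ∨ (f.map natDegree).sum = n := by
      by_contra h
      have : (if u = D.k ∨ (f.map natDegree).sum = n then Verdict.certain
        else Verdict.uncertain) = Verdict.certain := hv
      rw [if_neg h] at this
      cases this
    rcases hcert with huk | hdeg
    · by_contra hne
      exact (hfail hne).1.ne huk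
    -- A divisor of the minimal polynomial of degree `n` is the characteristic polynomial.
    · rw [← natDegree_multiset_prod_of_monic f fun g hg => (h₁ g hg).1] at hdeg
      have hc := eq_of_monic_of_dvd_of_natDegree_le hfm M.charpoly_monic
        (h₂.trans M.minpoly_dvd_charpoly) (by rw [hdeg, M.charpoly_natDegree_eq_dim]; simp)
      have hdvd : minpoly K M ∣ f.prod := by
        rw [← hc]
        exact M.minpoly_dvd_charpoly
      exact eq_of_monic_of_associated hfm (minpoly.monic (Matrix.isIntegral M))
        (associated_of_dvd_dvd h₂ hdvd)
  · have hfact := hB D.k D.p (fun j hj => ⟨hD.monic j hj, hD.pos j hj⟩)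
      (hD.len_eq.symm.trans hn) L hL'
    have hfact : (L.2.ops : ℝ) ≤ factB := Nat.cast_le.2 hfact
    simp only [add_zero, Nat.cast_add]
    exact add_le_add hfact hcost

/-! ### The probability that the chosen vectors lie in a given subspace -/

namespace Prog

/-- The law of the result of a randomised program. -/
noncomputable def value {α : Type u} (x : Prog α) : PMF α := x.law.map Prod.fst

theorem value_pure {α : Type u} (a : α) : (pure a : Prog α).value = PMF.pure a :=
  PMF.pure_map _ _

theorem value_det {α : Type u} (x : Counted α) : (det x).value = PMF.pure x.val :=
  PMF.pure_map _ _

theorem value_bind {α β : Type u} (x : Prog α) (f : α → Prog β) :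
    (x >>= f).value = x.value.bind fun a => (f a).value := by
  change PMF.map _ (PMF.bind _ _) = _
  simp only [value, PMF.map_bind, PMF.bind_map, PMF.pure_map]
  congr 1

theorem value_toOuterMeasure {α : Type u} (x : Prog α) (S : Set α) :
    x.value.toOuterMeasure S = x.law.toOuterMeasure {r | r.1 ∈ S} :=
  PMF.toOuterMeasure_map_apply _ _ _

theorem mem_support_value {α : Type u} {x : Prog α} {a : α} :
    a ∈ x.value.support ↔ ∃ t, (a, t) ∈ x.law.support := by
  simp only [value, PMF.mem_support_map_iff, Prod.exists, exists_and_right, exists_eq_right]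

end Prog

/-- If `S` has probability at most `c` after an outcome in `A`, and does not happen after other
outcomes, it has probability at most `P(A) * c`. -/
theorem PMF.toOuterMeasure_bind_le {α β : Type*} (p : PMF α) (f : α → PMF β) (A : Set α) (S : Set β)
    (c : ℝ≥0∞) (h₁ : ∀ a ∈ p.support, a ∈ A → (f a).toOuterMeasure S ≤ c)
    (h₂ : ∀ a ∈ p.support, a ∉ A → (f a).toOuterMeasure S = 0) :
    (p.bind f).toOuterMeasure S ≤ p.toOuterMeasure A * c := by
  rw [PMF.toOuterMeasure_bind_apply, PMF.toOuterMeasure_apply, ← ENNReal.tsum_mul_right]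
  refine ENNReal.tsum_le_tsum fun a => ?_
  by_cases hs : a ∈ p.support
  · by_cases ha : a ∈ A
    · rw [Set.indicator_of_mem ha]
      gcongr
      exact h₁ a hs ha
    · rw [h₂ a hs ha]
      simp
  · rw [(PMF.apply_eq_zero_iff p a).2 hs]
    simp

/-- The probability for a product of two uniform distributions as a quotient of cardinalities. -/
theorem PMF.toOuterMeasure_uniform_bind {α β γ : Type*} [Fintype α] [Nonempty α] (A : Finset β)
    (hA : A.Nonempty) (g : α → β → γ) (U : Set γ) :
    ((PMF.uniformOfFintype α).bind fun a => (PMF.uniformOfFinset A hA).map (g a)).toOuterMeasure U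
      = ({x : α × β | x.2 ∈ A ∧ g x.1 x.2 ∈ U}.ncard : ℝ≥0∞) / (Fintype.card α * A.card) := by
  classical
  rw [PMF.toOuterMeasure_bind_apply, tsum_fintype]
  simp only [PMF.toOuterMeasure_map_apply, PMF.toOuterMeasure_uniformOfFinset_apply,
    PMF.uniformOfFintype_apply]
  have hset : {x : α × β | x.2 ∈ A ∧ g x.1 x.2 ∈ U} =
      ((Finset.univ.sigma fun a => A.filter fun b => g a b ∈ U).map
        (Equiv.sigmaEquivProd α β).toEmbedding : Set (α × β)) := by
    ext ⟨a, b⟩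
    simp
  rw [hset, Set.ncard_coe_finset, Finset.card_map, Finset.card_sigma, Nat.cast_sum,
    ENNReal.div_eq_inv_mul, ENNReal.mul_inv (by simp) (by simp), mul_assoc, Finset.mul_sum,
    Finset.mul_sum]
  refine Finset.sum_congr rfl fun a _ => ?_
  rw [ENNReal.div_eq_inv_mul]
  rfl

theorem PMF.toOuterMeasure_le_one {α : Type*} (p : PMF α) (S : Set α) :
    p.toOuterMeasure S ≤ 1 :=
  (p.toOuterMeasure.mono (Set.subset_univ S)).trans_eq
    ((p.toOuterMeasure_apply_eq_one_iff _).2 (Set.subset_univ _))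

theorem comb_coord (S : ℕ → Fin n → K) {m : ℕ} (a : Fin m → K) :
    comb S m (coord a) = Fintype.linearCombination K (fun i : Fin m => S i) a := by
  rw [comb, Finset.sum_range, Fintype.linearCombination_apply]
  exact Finset.sum_congr rfl fun i _ => by simp [coord]

namespace SemiEchelon.Valid
variable {E : SemiEchelon K n} (hE : E.Valid)
include hE

/-- The vectors that vanish in the leading columns form a complement of the row space: uniqueness
of the decomposition. -/
theorem add_comb_injective {a a' : Fin E.len → K} {c c' : Fin n → K}
    (hc : ∀ i < E.len, coord c (E.l i) = 0) (hc' : ∀ i < E.len, coord c' (E.l i) = 0)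
    (h : c + comb E.S E.len (coord a) = c' + comb E.S E.len (coord a')) : a = a' ∧ c = c' := by
  have ha : comb E.S E.len (coord (a - a')) = c' - c := by
    rw [comb_coord, map_sub, ← comb_coord, ← comb_coord, sub_eq_sub_iff_add_eq_add, add_comm, h,
      add_comm]
  have h0 := hE.eq_zero_of_coord_comb (a := coord (a - a')) fun i hi => by
    rw [ha]
    have : coord (c' - c) (E.l i) = coord c' (E.l i) - coord c (E.l i) :=
      (coordForm K n (E.l i)).map_sub _ _
    rw [this, hc i hi, hc' i hi, sub_zero]
  have haa : a = a' := by
    funext i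
    have := h0 i i.2
    simp only [coord, i.2, dif_pos] at this
    exact sub_eq_zero.1 this
  subst haa
  exact ⟨rfl, add_right_cancel h⟩

/-- Existence of the decomposition: the remainder of CleanAndExtend lies in the complement. -/
theorem exists_add_comb_eq (v : Fin n → K) :
    ∃ (a : Fin E.len → K) (c : Fin n → K), (∀ i < E.len, coord c (E.l i) = 0) ∧
      c + comb E.S E.len (coord a) = v := by
  obtain ⟨h₁, h₂⟩ := hE.cleanLoop_spec v le_rfl
  refine ⟨fun i => (cleanLoop E v E.len).val.1 i, _, h₂, ?_⟩
  have : comb E.S E.len (coord fun i : Fin E.len => (cleanLoop E v E.len).val.1 i) =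
      comb E.S E.len (cleanLoop E v E.len).val.1 :=
    comb_congr (fun _ _ => rfl) fun j hj => by simp [coord, hj]
  rw [this, h₁, sub_add_cancel]

/-- A uniformly distributed vector outside of the row space lies in `U` with probability at most
the reciprocal of the index of `U`, here as an inequality of cardinalities. -/
theorem ncard_mul_pow_le [Fintype K] (A : Finset (Fin n → K))
    (hA : ∀ c, c ∈ A ↔ c ≠ 0 ∧ ∀ i < E.len, coord c (E.l i) = 0)
    (U : Submodule K (Fin n → K)) {d : ℕ} (hd : d ≤ Module.finrank K ((Fin n → K) ⧸ U)) :
    {x : (Fin E.len → K) × (Fin n → K) | x.2 ∈ A ∧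
      x.2 + comb E.S E.len (coord x.1) ∈ (U : Set (Fin n → K))}.ncard * Fintype.card K ^ d ≤
      Fintype.card (Fin E.len → K) * A.card := by
  classical
  set X := {x : (Fin E.len → K) × (Fin n → K) | x.2 ∈ A ∧
      x.2 + comb E.S E.len (coord x.1) ∈ (U : Set (Fin n → K))} with hX
  set γ := Fintype.linearCombination K (fun i : Fin E.len => E.S i) with hγ
  set N := LinearMap.ker (U.mkQ ∘ₗ γ) with hN
  have hq : 1 ≤ Fintype.card K := Fintype.card_pos
  have hcard : ∀ (W : Type u) [AddCommGroup W] [Module K W] [Finite W],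
      Nat.card W = Fintype.card K ^ Module.finrank K W := fun W _ _ _ => by
    rw [← Nat.card_eq_fintype_card]
    exact Module.natCard_eq_pow_finrank
  -- Besides the vectors counted in `X`, the space `U` contains its intersection with the row space,
  -- which is isomorphic to `N`.
  have h₁ : X.ncard + Nat.card N ≤ Nat.card U := by
    rw [← Nat.card_coe_set_eq, ← Nat.card_sum]
    have hmem : ∀ a : N, comb E.S E.len (coord a.1) ∈ U := fun a => by
      have : a.1 ∈ LinearMap.ker (U.mkQ ∘ₗ γ) := a.2
      rw [LinearMap.mem_ker, LinearMap.comp_apply, Submodule.mkQ_apply,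
        Submodule.Quotient.mk_eq_zero] at this
      rwa [comb_coord]
    refine Nat.card_le_card_of_injective (Sum.elim
      (fun x : X => (⟨_, x.2.2⟩ : U)) fun a : N => (⟨_, hmem a⟩ : U)) ?_
    have hz : ∀ i < E.len, coord (0 : Fin n → K) (E.l i) = 0 := fun i _ =>
      (coordForm K n (E.l i)).map_zero
    refine Function.Injective.sumElim (fun x y hxy => ?_) (fun a b hab => ?_) fun x a hxa => ?_
    · obtain ⟨h, h'⟩ := hE.add_comb_injective ((hA _).1 x.2.1).2 ((hA _).1 y.2.1).2
        (congrArg Subtype.val hxy)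
      exact Subtype.ext (Prod.ext h h')
    · exact Subtype.ext (hE.add_comb_injective hz hz
        (congrArg (fun v : U => (0 : Fin n → K) + v.1) hab)).1
    · refine ((hA _).1 x.2.1).1 (hE.add_comb_injective ((hA _).1 x.2.1).2 hz
        ((congrArg Subtype.val hxa).trans (zero_add _).symm)).2
  -- `A` together with zero is a complement of the row space.
  have h₂ : Fintype.card K ^ n ≤ Fintype.card (Fin E.len → K) * (A.card + 1) := by
    have h0 : (0 : Fin n → K) ∉ A := fun h => ((hA 0).1 h).1 rfl
    rw [← Finset.card_insert_of_notMem h0, ← Finset.card_univ (α := Fin E.len → K),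
      ← Finset.card_product]
    calc Fintype.card K ^ n = (Finset.univ : Finset (Fin n → K)).card := by simp
      _ ≤ _ := Finset.card_le_card_of_surjOn
        (fun x : (Fin E.len → K) × (Fin n → K) => x.2 + comb E.S E.len (coord x.1)) ?_
    intro v _
    obtain ⟨a, c, hc, rfl⟩ := hE.exists_add_comb_eq v
    refine ⟨(a, c), ?_, rfl⟩
    by_cases hc0 : c = 0
    · simp [hc0]
    · simpa [hc0] using (hA c).2 ⟨hc0, hc⟩
  have h₃ : Module.finrank K U + Module.finrank K ((Fin n → K) ⧸ U) = n := by
    rw [add_comm, Submodule.finrank_quotient_add_finrank, Module.finrank_fin_fun]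
  have h₄ : E.len ≤ Module.finrank K N + Module.finrank K ((Fin n → K) ⧸ U) := by
    have h := LinearMap.finrank_range_add_finrank_ker (U.mkQ ∘ₗ γ)
    rw [← hN, Module.finrank_fin_fun] at h
    have := (LinearMap.range (U.mkQ ∘ₗ γ)).finrank_le
    omega
  rw [hcard, hcard] at h₁
  rw [Fintype.card_fun, Fintype.card_fin] at h₂ ⊢
  set e := Module.finrank K ((Fin n → K) ⧸ U)
  set q := Fintype.card K
  have h₅ : q ^ Module.finrank K U * q ^ e = q ^ n := by rw [← pow_add, h₃]
  have h₆ : q ^ E.len ≤ q ^ Module.finrank K N * q ^ e := by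
    rw [← pow_add]; exact Nat.pow_le_pow_right hq h₄
  have h₇ : X.ncard * q ^ d ≤ X.ncard * q ^ e :=
    Nat.mul_le_mul_left _ (Nat.pow_le_pow_right hq hd)
  have h₈ := Nat.mul_le_mul_right (q ^ e) h₁
  rw [add_mul] at h₈
  rw [mul_add] at h₂
  omega

end SemiEchelon.Valid

/-! ### The law of the chosen vectors -/

open Classical in
/-- The law of the vector that is chosen in a round of CharPoly: uniform outside of the row space
of `E`. The value for a row space of dimension `n` is irrelevant. -/
noncomputable def vectorLaw [Fintype K] (E : SemiEchelon K n) : PMF (Fin n → K) :=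
  (Prog.randomVector K E.len).value.bind fun a =>
    (Prog.randomVectorNeZero E).value.map fun c => c + comb E.S E.len a

theorem charLoop_succ_value [Fintype K] (M : Matrix (Fin n) (Fin n) K) (R : ℕ) {D : CharData K n}
    (h : D.E.len < n) :
    (charLoop M (R + 1) D).value =
      (vectorLaw D.E).bind fun v => (charLoop M R (D.next M v)).value := by
  rw [charLoop, if_pos h, vectorLaw]
  simp only [Prog.value_bind, Prog.value_det, PMF.pure_bind, val_sum_smul, PMF.bind_bind,
    PMF.bind_map]
  rfl

theorem notMem_of_mem_support_vectorLaw [Fintype K] {E : SemiEchelon K n} (hE : E.Valid)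
    (h : E.len < n) {v : Fin n → K} (hv : v ∈ (vectorLaw E).support) :
    v ∉ rowSpan E.Y E.len := by
  rw [vectorLaw, PMF.mem_support_bind_iff] at hv
  obtain ⟨a, -, hv⟩ := hv
  obtain ⟨c, hc, rfl⟩ := (PMF.mem_support_map_iff _ _ _).1 hv
  obtain ⟨t, ht⟩ := Prog.mem_support_value.1 hc
  obtain ⟨h₁, h₂, -⟩ := Prog.of_mem_support_randomVectorNeZero hE h ht
  exact add_comb_notMem hE h₁ h₂ a

/-- A chosen vector lies in a subspace of codimension at least `d` with probability at most
`|K| ^ (-d)`. -/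
theorem vectorLaw_le [Fintype K] {E : SemiEchelon K n} (hE : E.Valid) (h : E.len < n)
    (U : Submodule K (Fin n → K)) {d : ℕ} (hd : d ≤ Module.finrank K ((Fin n → K) ⧸ U)) :
    (vectorLaw E).toOuterMeasure U ≤ ((Fintype.card K : ℝ≥0∞) ^ d)⁻¹ := by
  classical
  obtain ⟨c, hc₀, hc⟩ := Prog.exists_coord_eq_zero hE h
  set A : Finset (Fin n → K) :=
    Finset.univ.filter fun v => v ≠ 0 ∧ ∀ i < E.len, coord v (E.l i) = 0 with hA
  have hne : A.Nonempty := ⟨c, by simpa [hA] using ⟨hc₀, hc⟩⟩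
  have h₁ : (Prog.randomVector K E.len).value =
      (PMF.uniformOfFintype (Fin E.len → K)).map coord := by
    rw [Prog.value, Prog.randomVector, PMF.map_comp]
    rfl
  have h₂ : (Prog.randomVectorNeZero E).value = PMF.uniformOfFinset A hne := by
    rw [Prog.value, Prog.randomVectorNeZero]
    dsimp only
    split
    · rw [PMF.map_comp]
      convert PMF.map_id _
      rfl
    next hemp => exact absurd hne (by convert hemp)
  rw [vectorLaw, h₁, h₂, PMF.bind_map]
  have h₃ := PMF.toOuterMeasure_uniform_bind (α := Fin E.len → K) A hne
    (fun a c => c + comb E.S E.len (coord a)) (U : Set (Fin n → K))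
  have h₄ := hE.ncard_mul_pow_le A (by simp [hA]) U hd
  refine h₃.trans_le (ENNReal.div_le_of_le_mul ?_)
  have hq0 : (Fintype.card K : ℝ≥0∞) ^ d ≠ 0 := by simp
  have hqt : (Fintype.card K : ℝ≥0∞) ^ d ≠ ∞ := by simp
  rw [mul_comm, ← div_eq_mul_inv, ENNReal.le_div_iff_mul_le (Or.inl hq0) (Or.inl hqt)]
  exact_mod_cast h₄

/-- By induction on the rounds; given the earlier rounds, the next vector has the law `vectorLaw`, so
no independence is needed. -/
theorem charLoop_prob_le [Fintype K] (M : Matrix (Fin n) (Fin n) K) (U : Submodule K (Fin n → K))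
    {d : ℕ} (hd : d ≤ Module.finrank K ((Fin n → K) ⧸ U)) (m R : ℕ) {D : CharData K n}
    (hD : D.Valid M) (hR : n ≤ R + D.E.len) (hm : D.k ≤ m) :
    (charLoop M R D).value.toOuterMeasure
        {D' | m ≤ D'.k ∧ ∀ i, D.k ≤ i → i < m → D'.E.Y (D'.s i) ∈ U} ≤
      ((Fintype.card K : ℝ≥0∞) ^ d)⁻¹ ^ (m - D.k) := by
  have hpure : ∀ D : CharData K n, D.k < m → (PMF.pure D).toOuterMeasure
      {D' | m ≤ D'.k ∧ ∀ i, D.k ≤ i → i < m → D'.E.Y (D'.s i) ∈ U} ≤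
      ((Fintype.card K : ℝ≥0∞) ^ d)⁻¹ ^ (m - D.k) := fun D hlt => by
    rw [PMF.toOuterMeasure_pure_apply, if_neg fun h => absurd h.1 hlt.not_ge]
    exact zero_le
  rcases hm.eq_or_lt with rfl | hm
  · simpa using PMF.toOuterMeasure_le_one _ _
  induction R generalizing D with
  | zero => rw [charLoop, Prog.value_pure]; exact hpure D hm
  | succ R ih =>
    by_cases hlt : D.E.len < n
    · rw [charLoop_succ_value M R hlt]
      have hexp : m - D.k = m - (D.k + 1) + 1 := by omega
      rw [hexp, pow_succ']
      refine (PMF.toOuterMeasure_bind_le _ _ U _ (((Fintype.card K : ℝ≥0∞) ^ d)⁻¹ ^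
        (m - (D.k + 1))) (fun v hv hvU => ?_) fun v hv hvU => ?_).trans
        (mul_le_mul_left (vectorLaw_le hD.E_valid hlt U hd) _)
      · obtain ⟨h₁, h₂, h₃, h₄, -⟩ :=
          hD.next (notMem_of_mem_support_vectorLaw hD.E_valid hlt hv)
        have hk : (D.next M v).k = D.k + 1 := rfl
        rcases (Nat.succ_le_of_lt hm).eq_or_lt with heq | hlt'
        · rw [← heq, Nat.sub_self, pow_zero]
          exact PMF.toOuterMeasure_le_one _ _
        · refine (MeasureTheory.OuterMeasure.mono _ ?_).trans
            (ih h₁ (by omega) (Nat.succ_le_of_lt hm) hlt')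
          exact fun D' hD' => ⟨hD'.1, fun i hi => hD'.2 i (by omega)⟩
      · obtain ⟨h₁, h₂, h₃, h₄, -⟩ :=
          hD.next (notMem_of_mem_support_vectorLaw hD.E_valid hlt hv)
        rw [PMF.toOuterMeasure_apply_eq_zero_iff, Set.disjoint_left]
        rintro D' hD' ⟨-, hU⟩
        obtain ⟨t, ht⟩ := Prog.mem_support_value.1 hD'
        obtain ⟨-, -, hext, -⟩ := charLoop_spec M R h₁ (by omega) ht
        refine hvU ?_
        have hs : D'.s D.k = D.s D.k :=
          (hext.s_eq h₂.k_le).trans (h₂.s_eq le_rfl)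
        have := hU D.k le_rfl hm
        rwa [hs, hext.Y_eq _ (by rw [← h₁.len_eq, ← hD.len_eq]; exact h₄), h₃] at this
    · rw [charLoop, if_neg hlt, Prog.value_pure]
      exact hpure D hm

/-- The probability that at least `m` vectors are chosen, and the first `m` of them lie in `U`. -/
theorem charPoly_prob_le [Fintype K] (M : Matrix (Fin n) (Fin n) K) (U : Submodule K (Fin n → K))
    {d : ℕ} (hd : d ≤ Module.finrank K ((Fin n → K) ⧸ U)) (m : ℕ) :
    (charPoly M).value.toOuterMeasure {D | m ≤ D.k ∧ ∀ i < m, D.E.Y (D.s i) ∈ U} ≤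
      ((Fintype.card K : ℝ≥0∞) ^ d)⁻¹ ^ m := by
  rw [charPoly]
  simpa using charLoop_prob_le M U hd m n (CharData.valid_init M) (by simp) (Nat.zero_le m)

/-- The image of `v ↦ v e(M)`, where `e` is the minimal polynomial divided by `q`, contains a
vector whose order polynomial is `q`. -/
theorem natDegree_le_finrank_quotient {M : Matrix (Fin n) (Fin n) K} {q : K[X]}
    (hq : q ∈ irreducibleFactors M.charpoly) :
    q.natDegree ≤ Module.finrank K
      ((Fin n → K) ⧸ LinearMap.ker (rowAct M (minpoly K M /ₘ q))) := by
  have hnd := not_minpoly_dvd_divByMonic hq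
  obtain ⟨hqi, hqm, e, he⟩ := Matrix.mem_irreducibleFactors_charpoly.1 hq
  rw [he, mul_divByMonic_cancel_left _ hqm] at hnd ⊢
  rw [← he, minpoly_dvd_iff_rowAct] at hnd
  push Not at hnd
  obtain ⟨v, hv⟩ := hnd
  rw [(rowAct M e).quotKerEquivRange.finrank_eq]
  -- If `v e(M) ≠ 0`, the polynomials `g` of degree less than `deg q` are mapped injectively to
  -- `v g(M) e(M)`, since `q` is irreducible.
  let f : (Fin q.natDegree → K) →ₗ[K] LinearMap.range (rowAct M e) :=
    { toFun := fun a => ⟨rowAct M e (rowAct M ((degreeLTEquiv K q.natDegree).symm a).1 v), _, rfl⟩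
      map_add' := fun a b => by ext1; simp
      map_smul' := fun c a => by ext1; simp }
  have hf : Function.Injective f := by
    rw [← LinearMap.ker_eq_bot, LinearMap.ker_eq_bot']
    intro a ha
    have ha : rowAct M e (rowAct M ((degreeLTEquiv K q.natDegree).symm a).1 v) = 0 :=
      congrArg Subtype.val ha
    set h := (degreeLTEquiv K q.natDegree).symm a with hh
    by_contra ha0
    have hh0 : h.1 ≠ 0 := fun h0 => ha0 (by
      rw [← (degreeLTEquiv K q.natDegree).symm.map_eq_zero_iff]
      exact Subtype.ext h0)
    have hdeg : h.1.natDegree < q.natDegree := by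
      rw [natDegree_lt_iff_degree_lt hh0]
      exact mem_degreeLT.1 h.2
    obtain ⟨x, y, hxy⟩ := hqi.coprime_iff_not_dvd.2 fun hdvd =>
      absurd (natDegree_le_of_dvd hdvd hh0) (by omega)
    have hμ : rowAct M q (rowAct M e v) = 0 := by
      rw [← rowAct_mul, ← he]
      exact (minpoly_dvd_iff_rowAct M _).1 dvd_rfl v
    apply hv
    rw [← rowAct_one M (rowAct M e v), ← hxy, map_add, LinearMap.add_apply, rowAct_mul, hμ,
      rowAct_mul, rowAct_comm M h.1, ha, map_zero, map_zero, add_zero]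
  simpa using LinearMap.finrank_le_finrank_of_injective hf

/-! ### The number of vectors and the probability of success -/

theorem card_irreducibleFactors_le (M : Matrix (Fin n) (Fin n) K) :
    (irreducibleFactors M.charpoly).card ≤ n := by
  classical
  have h0 := M.charpoly_monic.ne_zero
  set m := UniqueFactorizationMonoid.normalizedFactors M.charpoly with hm
  have hmon : ∀ g ∈ m, g.Monic := fun g hg => ((Polynomial.mem_normalizedFactors_iff h0).1 hg).2.1
  have hdeg : (m.map natDegree).sum = n := by
    rw [← natDegree_multiset_prod_of_monic m hmon, natDegree_eq_of_degree_eq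
      (degree_eq_degree_of_associated (UniqueFactorizationMonoid.prod_normalizedFactors h0)),
      M.charpoly_natDegree_eq_dim, Fintype.card_fin]
  have hcard : m.card ≤ (m.map natDegree).sum := by
    have := Multiset.card_nsmul_le_sum (s := m.map natDegree) (a := 1) fun d hd => by
      obtain ⟨g, hg, rfl⟩ := Multiset.mem_map.1 hd
      exact ((Polynomial.mem_normalizedFactors_iff h0).1 hg).1.natDegree_pos
    simpa using this
  exact (Multiset.toFinset_card_le m).trans (hcard.trans hdeg.le)

section
variable [Fintype K]

theorem sum_irreducibleFactors_le (M : Matrix (Fin n) (Fin n) K) {ε : ℝ} {u : ℕ}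
    (h : (n : ℝ) ≤ ε * (Fintype.card K : ℝ) ^ u) :
    ∑ g ∈ irreducibleFactors M.charpoly, ((Fintype.card K : ℝ) ^ (u * g.natDegree))⁻¹ ≤ ε := by
  have hq : (1 : ℝ) ≤ Fintype.card K := Nat.one_le_cast.2 Fintype.card_pos
  have hpos : (0 : ℝ) < (Fintype.card K : ℝ) ^ u := by positivity
  calc _ ≤ ∑ g ∈ irreducibleFactors M.charpoly, ((Fintype.card K : ℝ) ^ u)⁻¹ := by
        refine Finset.sum_le_sum fun g hg => ?_
        have hg := (Matrix.mem_irreducibleFactors_charpoly.1 hg).1.natDegree_pos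
        gcongr
        exact Nat.le_mul_of_pos_right u hg
    _ ≤ n * ((Fintype.card K : ℝ) ^ u)⁻¹ := by
        rw [Finset.sum_const, nsmul_eq_mul]
        gcongr
        exact card_irreducibleFactors_le M
    _ ≤ ε := by rwa [← div_eq_mul_inv, div_le_iff₀ hpos]

/-- The set of which `roundBound` is the infimum is not empty. -/
theorem roundBound_spec (M : Matrix (Fin n) (Fin n) K) {ε : ℝ} (hε : 0 < ε) :
    ∑ g ∈ irreducibleFactors M.charpoly,
      ((Fintype.card K : ℝ) ^ (roundBound M ε * g.natDegree))⁻¹ ≤ ε := by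
  have hq : (1 : ℝ) < Fintype.card K := Nat.one_lt_cast.2 Fintype.one_lt_card
  obtain ⟨u, hu⟩ := pow_unbounded_of_one_lt (n / ε) hq
  rw [div_lt_iff₀' hε] at hu
  exact Nat.sInf_mem (s := {u : ℕ | ∑ g ∈ irreducibleFactors M.charpoly,
    ((Fintype.card K : ℝ) ^ (u * g.natDegree))⁻¹ ≤ ε}) ⟨u, sum_irreducibleFactors_le M hu.le⟩

theorem roundBound_le (M : Matrix (Fin n) (Fin n) K) {ε : ℝ} {u : ℕ}
    (h : (n : ℝ) ≤ ε * (Fintype.card K : ℝ) ^ u) : roundBound M ε ≤ u :=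
  Nat.sInf_le (sum_irreducibleFactors_le M h)

/-- A union bound over the irreducible factors `q`: in a failing run the first `u` vectors lie in the
kernel of `(minpoly K M /ₘ q)(M)` for one of them. -/
theorem minPolyMC_failure_le (F : Factoriser K) (M : Matrix (Fin n) (Fin n) K) {ε : ℝ}
    (hε : 0 < ε) :
    (minPolyMC F M ε).law.toOuterMeasure {r | r.1.f ≠ minpoly K M} ≤ ENNReal.ofReal ε := by
  set u := roundBound M ε with hu
  set bad : K[X] → Set (CharData K n) := fun q => {D | u ≤ D.k ∧ ∀ i < u,
    D.E.Y (D.s i) ∈ LinearMap.ker (rowAct M (minpoly K M /ₘ q))} with hbad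
  have h₁ : (minPolyMC F M ε).law.toOuterMeasure {r | r.1.f ≠ minpoly K M} ≤
      (charPoly M).value.toOuterMeasure (⋃ q ∈ irreducibleFactors M.charpoly, bad q) := by
    have h := Prog.value_toOuterMeasure (minPolyMC F M ε) {r | r.f ≠ minpoly K M}
    refine h.ge.trans ?_
    rw [minPolyMC_eq_bind, Prog.value_bind]
    refine (PMF.toOuterMeasure_bind_le _ _ _ _ 1
      (fun D _ _ => PMF.toOuterMeasure_le_one _ _) fun D hD hDbad => ?_).trans (mul_one _).le
    obtain ⟨t, ht⟩ := Prog.mem_support_value.1 hD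
    obtain ⟨hV, hn, -⟩ := charPoly_spec M ht
    rw [PMF.toOuterMeasure_apply_eq_zero_iff, Set.disjoint_left]
    intro r hr hne
    obtain ⟨t', ht'⟩ := Prog.mem_support_value.1 hr
    obtain ⟨-, -, hru, -, -, -, -, hfail, -⟩ := afterCharPoly_spec F ε hV hn ht'
    obtain ⟨hlt, q, hq, hker⟩ := hfail hne
    dsimp only at hru hlt hker
    have hru' : r.u = u := by omega
    rw [hru'] at hlt hker
    exact hDbad (Set.mem_biUnion hq ⟨hlt.le, fun i hi => hker i hi⟩)
  refine h₁.trans ((MeasureTheory.measure_biUnion_finset_le _ _).trans ?_)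
  refine (Finset.sum_le_sum fun q hq =>
    charPoly_prob_le M _ (natDegree_le_finrank_quotient hq) u).trans ?_
  refine le_trans (le_of_eq ?_) (ENNReal.ofReal_le_ofReal (roundBound_spec M hε))
  rw [ENNReal.ofReal_sum_of_nonneg fun _ _ => by positivity]
  refine Finset.sum_congr rfl fun q _ => ?_
  have hq : (0 : ℝ) < Fintype.card K := Nat.cast_pos.2 Fintype.card_pos
  rw [ENNReal.ofReal_inv_of_pos (by positivity), ENNReal.ofReal_pow hq.le, ENNReal.ofReal_natCast,
    ENNReal.inv_pow, ← pow_mul, ← ENNReal.inv_pow, mul_comm]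

theorem minPolyMC_success_ge (F : Factoriser K) (M : Matrix (Fin n) (Fin n) K) {ε : ℝ}
    (hε : 0 < ε) :
    ENNReal.ofReal (1 - ε) ≤
      (minPolyMC F M ε).law.toOuterMeasure {r | r.1.f = minpoly K M} := by
  rw [ENNReal.ofReal_sub 1 hε.le, ENNReal.ofReal_one, tsub_le_iff_right]
  refine le_trans ?_ (add_le_add_right (minPolyMC_failure_le F M hε) _)
  refine le_trans (le_of_eq ?_) (MeasureTheory.measure_union_le _ _)
  refine ((PMF.toOuterMeasure_apply_eq_one_iff _ _).2 fun r _ => ?_).symm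
  exact em _

/-! ### What holds in every run -/

theorem minPolyMC_spec (F : Factoriser K) (M : Matrix (Fin n) (Fin n) K) (ε : ℝ)
    {r : MinPolyResult K × Tally} (hr : r ∈ (minPolyMC F M ε).law.support) :
    (r.1.verdict = Verdict.certain → r.1.f = minpoly K M) ∧ r.1.f.Monic ∧
      r.1.f ∣ minpoly K M ∧ (∀ g : K[X], Irreducible g → g ∣ minpoly K M → g ∣ r.1.f) ∧
      r.1.u = min (roundBound M ε) r.1.k ∧ (∀ i ≤ r.1.k, r.1.s i ≤ n) ∧
      (∀ charB factB : ℕ, IsCharBound K n charB → IsFactBound F n factB →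
        (r.2.ops : ℝ) ≤ charB + factB +
          ∑ i ∈ Finset.Icc 1 r.1.u, ((i : ℝ) / 2 + 9) * (r.1.s i : ℝ) ^ 2) ∧
      r.1.k ≤ n ∧ ∀ ξ : ℕ → ℝ, IsDrawCost ξ → (r.2.draws.map ξ).sum ≤ r.1.k * ξ n := by
  rw [minPolyMC_eq_bind] at hr
  obtain ⟨⟨D, t⟩, hD, r, hr', rfl⟩ := Prog.mem_support_bind.1 hr
  obtain ⟨hV, hn, -, hdraws⟩ := charPoly_spec M hD
  obtain ⟨hk, hs, hu, hd, hmon, hdvd, hirr, -, hcert, hops⟩ := afterCharPoly_spec F ε hV hn hr'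
  dsimp only at *
  have hsk : D.s D.k = n := hV.len_eq.symm.trans hn
  refine ⟨hcert, hmon, hdvd, hirr, hk.symm ▸ hu, fun i hi => ?_, fun charB factB hc hf => ?_, ?_,
    fun ξ hξ => ?_⟩
  · rw [hs]
    exact (D.s_mono (hk ▸ hi)).trans hsk.le
  · have h₁ : (t.ops : ℝ) ≤ charB := Nat.cast_le.2 (hc M _ hD)
    have h₂ := hops factB hf
    push_cast
    linarith
  · have := Finset.card_nsmul_le_sum (Finset.range D.k) (fun i => (D.p i).natDegree) 1
      fun i hi => hV.pos i (Finset.mem_range.1 hi)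
    have hks : D.k ≤ D.s D.k := by simpa [CharData.s] using this
    rw [hk]
    exact hks.trans hsk.le
  · rw [hd, List.append_nil, hk]
    exact hdraws ξ hξ

end

/-! ### The bounds for large matrices -/

/-- A concrete bound `char(n, q)`, independent of `q`. -/
theorem isCharBound_sum_roundCost (K : Type u) [Field K] [Fintype K] (n : ℕ) :
    IsCharBound K n (∑ i ∈ Finset.range n, CharData.roundCost n i) :=
  fun M _ hr => (charPoly_spec M hr).2.2.1

theorem sum_roundCost_le (n : ℕ) :
    ((∑ i ∈ Finset.range n, CharData.roundCost n i : ℕ) : ℝ) ≤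
      17 / 3 * (n : ℝ) ^ 3 + 5 * (n : ℝ) ^ 2 := by
  have h : ∀ m : ℕ, ((∑ i ∈ Finset.range m, CharData.roundCost n i : ℕ) : ℝ) =
      3 * n * m * (m - 1) + m * (m - 1) * (2 * m - 1) / 3 + 5 / 2 * m * (m - 1) +
        (2 * (n : ℝ) ^ 2 + 3 * n + 5) * m := by
    intro m
    induction m with
    | zero => simp
    | succ m ih =>
      rw [Finset.sum_range_succ, Nat.cast_add, ih, CharData.roundCost, SemiEchelon.extendCost]
      push_cast
      ring
  have hn : (n : ℝ) ≤ (n : ℝ) ^ 2 := by exact_mod_cast Nat.le_self_pow two_ne_zero n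
  rw [h]
  nlinarith

/-- If `s` is bounded by `n`, the sum over the first `u` vectors is bounded by a multiple of `n ^ 2`
with leading coefficient `u ^ 2 / 4`. The constant `257` bounds `37 / 4 * m - m ^ 2 / 12`. -/
theorem sum_ordCost_le {n u : ℕ} {s : ℕ → ℕ} (hs : ∀ i ≤ u, s i ≤ n) {m : ℝ} (hm : u ≤ m) :
    ∑ i ∈ Finset.Icc 1 u, ((i : ℝ) / 2 + 9) * (s i : ℝ) ^ 2 ≤
      (1 / 3 * m ^ 2 + 257) * (n : ℝ) ^ 2 := by
  have h₁ : ∑ i ∈ Finset.Icc 1 u, ((i : ℝ) / 2 + 9) * (s i : ℝ) ^ 2 ≤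
      ∑ i ∈ Finset.Icc 1 u, ((i : ℝ) / 2 + 9) * (n : ℝ) ^ 2 := by
    refine Finset.sum_le_sum fun i hi => ?_
    have := hs i (Finset.mem_Icc.1 hi).2
    gcongr
  have h₂ : ∀ u : ℕ, ∑ i ∈ Finset.Icc 1 u, ((i : ℝ) / 2 + 9) =
      (u : ℝ) ^ 2 / 4 + 37 / 4 * u := by
    intro u
    induction u with
    | zero => simp
    | succ u ih =>
      rw [Finset.sum_Icc_succ_top (by omega), ih]
      push_cast
      ring
  refine h₁.trans ?_
  rw [← Finset.sum_mul, h₂]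
  have hu : (0 : ℝ) ≤ u := Nat.cast_nonneg u
  have hum : (u : ℝ) ^ 2 ≤ m ^ 2 := by gcongr
  refine mul_le_mul_of_nonneg_right ?_ (sq_nonneg _)
  linarith [sq_nonneg ((u : ℝ) - 111 / 2)]

/-- The ceiling of `log_q (n / ε)` as an exponent of `q`. -/
theorem le_mul_pow_ceil {n q : ℕ} (hn : 0 < n) (hq : 1 < q) {ε : ℝ} (hε₀ : 0 < ε) (hε₁ : ε < 1) :
    0 ≤ ⌈(Real.logb 2 n - Real.logb 2 ε) / Real.logb 2 q⌉ ∧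
      (n : ℝ) ≤ ε * (q : ℝ) ^ ⌈(Real.logb 2 n - Real.logb 2 ε) / Real.logb 2 q⌉.toNat := by
  have hl2 : 0 < Real.log 2 := Real.log_pos one_lt_two
  have hlq : 0 < Real.log q := Real.log_pos (Nat.one_lt_cast.2 hq)
  have hln : 0 ≤ Real.log n := Real.log_natCast_nonneg n
  have hle : Real.log ε < 0 := Real.log_neg hε₀ hε₁
  have hn' : (0 : ℝ) < n := Nat.cast_pos.2 hn
  have hx : (Real.logb 2 n - Real.logb 2 ε) / Real.logb 2 q =
      (Real.log n - Real.log ε) / Real.log q := by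
    simp only [Real.logb]
    field_simp
  rw [hx]
  have h0 : 0 ≤ ⌈(Real.log n - Real.log ε) / Real.log q⌉ :=
    Int.ceil_nonneg (div_nonneg (by linarith) hlq.le)
  refine ⟨h0, ?_⟩
  set m := ⌈(Real.log n - Real.log ε) / Real.log q⌉ with hm
  have hmc : ((m.toNat : ℕ) : ℝ) = m := by
    exact_mod_cast Int.toNat_of_nonneg h0
  have hceil : (Real.log n - Real.log ε) / Real.log q ≤ m := Int.le_ceil _
  rw [div_le_iff₀ hlq, ← hmc, ← Real.log_pow, ← Real.log_div hn'.ne' hε₀.ne',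
    Real.log_le_log_iff (by positivity) (by positivity), div_le_iff₀ hε₀, mul_comm] at hceil
  exact hceil

/-- The ceiling is at most `logb 2 n + c` for all `q ≥ 2`, with `c` depending only on `ε`. -/
theorem exists_ceil_sq_lt {ε : ℝ} (hε₀ : 0 < ε) (hε₁ : ε < 1) :
    ∃ N : ℕ, ∀ n : ℕ, N ≤ n → ∀ q : ℕ, 1 < q →
      1 / 3 * (⌈(Real.logb 2 n - Real.logb 2 ε) / Real.logb 2 q⌉ : ℝ) ^ 2 < n := by
  have hl2 : 0 < Real.log 2 := Real.log_pos one_lt_two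
  set c := 1 - Real.logb 2 ε with hc
  have h₁ : ∀ᶠ x : ℝ in Filter.atTop, 2 * (Real.logb 2 x) ^ 2 ≤ x := by
    have := (Real.isLittleO_pow_log_id_atTop (n := 2)).bound
      (show 0 < (Real.log 2) ^ 2 / 2 by positivity)
    filter_upwards [this, Filter.eventually_ge_atTop 0] with x hx hx0
    rw [Real.norm_of_nonneg (sq_nonneg _), id, Real.norm_of_nonneg hx0] at hx
    rw [Real.logb, div_pow]
    field_simp
    linarith
  have h₂ : ∀ᶠ x : ℝ in Filter.atTop, 2 * c ^ 2 ≤ x ∧ 1 ≤ x :=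
    (Filter.eventually_ge_atTop _).and (Filter.eventually_ge_atTop _)
  obtain ⟨N, hN⟩ := Filter.eventually_atTop.1
    ((tendsto_natCast_atTop_atTop (R := ℝ)).eventually (h₁.and h₂))
  refine ⟨N, fun n hn q hq => ?_⟩
  obtain ⟨g₁, g₂, g₃⟩ := hN n hn
  have hn0 : 0 < n := by exact_mod_cast (zero_lt_one.trans_le g₃)
  have h0 := (le_mul_pow_ceil hn0 hq hε₀ hε₁).1
  have hlt := Int.ceil_lt_add_one ((Real.logb 2 n - Real.logb 2 ε) / Real.logb 2 q)
  have hlq : 1 ≤ Real.logb 2 q := by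
    rw [Real.le_logb_iff_rpow_le one_lt_two (by positivity), Real.rpow_one]
    exact_mod_cast hq
  have hnum : 0 ≤ Real.logb 2 n - Real.logb 2 ε := by
    have := Real.logb_nonneg one_lt_two g₃
    have := Real.logb_neg one_lt_two hε₀ hε₁
    linarith
  have hdiv := div_le_self hnum hlq
  set m : ℤ := ⌈(Real.logb 2 n - Real.logb 2 ε) / Real.logb 2 q⌉
  have hm0 : (0 : ℝ) ≤ m := by exact_mod_cast h0
  have hmle : (m : ℝ) ≤ Real.logb 2 n + c := by linarith
  have hsq : (m : ℝ) ^ 2 ≤ (Real.logb 2 n + c) ^ 2 := by gcongr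
  nlinarith [sq_nonneg (Real.logb 2 n - c)]

end

theorem theorem1 (ε : ℝ) (hε₀ : 0 < ε) (hε₁ : ε < 1 / 2) :
    (∀ (K : Type u) [Field K] [Fintype K] (F : Factoriser K) (n : ℕ)
      (M : Matrix (Fin n) (Fin n) K),
      -- the probability of success
      ENNReal.ofReal (1 - ε) ≤
        (minPolyMC F M ε).law.toOuterMeasure {r | r.1.f = minpoly K M} ∧
      ∀ r ∈ (minPolyMC F M ε).law.support,
        -- what holds for every output
        (r.1.verdict = Verdict.certain → r.1.f = minpoly K M) ∧
        r.1.f.Monic ∧ r.1.f ∣ minpoly K M ∧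
        (r.1.f ≠ minpoly K M → ¬ minpoly K M ∣ r.1.f) ∧
        (∀ g : K[X], Irreducible g → g ∣ minpoly K M → g ∣ r.1.f) ∧
        (r.1.u = r.1.k ∨
          (r.1.u < r.1.k ∧
            ∑ g ∈ irreducibleFactors M.charpoly,
              ((Fintype.card K : ℝ) ^ (r.1.u * g.natDegree))⁻¹ ≤ ε)) ∧
        -- the number of elementary field operations
        (∀ charB factB : ℕ, IsCharBound K n charB → IsFactBound F n factB →
          (r.2.ops : ℝ) ≤ charB + factB +
            ∑ i ∈ Finset.Icc 1 r.1.u, ((i : ℝ) / 2 + 9) * (r.1.s i : ℝ) ^ 2) ∧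
        -- the cost of the random vectors
        r.1.k ≤ n ∧
        ∀ ξ : ℕ → ℝ, IsDrawCost ξ →
          (r.2.draws.map ξ).sum ≤ r.1.k * ξ n ∧ r.1.k * ξ n ≤ n * ξ n) ∧
    -- the bounds for large `n`
    ∃ N : ℕ, ∀ (K : Type u) [Field K] [Fintype K] (n : ℕ), N ≤ n →
      ∃ charB : ℕ, IsCharBound K n charB ∧
        ∀ (F : Factoriser K) (factB : ℕ), IsFactBound F n factB →
          ∀ (M : Matrix (Fin n) (Fin n) K), ∀ r ∈ (minPolyMC F M ε).law.support,
            (r.2.ops : ℝ) ≤ charB + factB +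
              ∑ i ∈ Finset.Icc 1 r.1.u, ((i : ℝ) / 2 + 9) * (r.1.s i : ℝ) ^ 2 ∧
            (charB : ℝ) + factB +
                ∑ i ∈ Finset.Icc 1 r.1.u, ((i : ℝ) / 2 + 9) * (r.1.s i : ℝ) ^ 2 <
              6 * (n : ℝ) ^ 3 + factB +
                1 / 3 * (⌈(Real.logb 2 n - Real.logb 2 ε) /
                  Real.logb 2 (Fintype.card K)⌉ : ℝ) ^ 2 * (n : ℝ) ^ 2 ∧
            6 * (n : ℝ) ^ 3 + factB +
                1 / 3 * (⌈(Real.logb 2 n - Real.logb 2 ε) /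
                  Real.logb 2 (Fintype.card K)⌉ : ℝ) ^ 2 * (n : ℝ) ^ 2 <
              7 * (n : ℝ) ^ 3 + factB := by
  have hε₂ : ε < 1 := by linarith
  refine ⟨fun K _ _ F n M => ⟨minPolyMC_success_ge F M hε₀, fun r hr => ?_⟩, ?_⟩
  · obtain ⟨h₁, h₂, h₃, h₄, h₅, -, h₆, h₇, h₈⟩ := minPolyMC_spec F M ε hr
    refine ⟨h₁, h₂, h₃, fun hne hdvd => hne ?_, h₄, ?_, h₆, h₇, fun ξ hξ => ⟨h₈ ξ hξ, ?_⟩⟩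
    · exact eq_of_monic_of_associated h₂ (minpoly.monic (Matrix.isIntegral M))
        (associated_of_dvd_dvd h₃ hdvd)
    · rcases le_or_gt r.1.k (roundBound M ε) with hle | hlt
      · exact Or.inl (h₅.trans (min_eq_right hle))
      · have hu : r.1.u = roundBound M ε := h₅.trans (min_eq_left hlt.le)
        exact Or.inr ⟨hu ▸ hlt, hu ▸ roundBound_spec M hε₀⟩
    · exact mul_le_mul_of_nonneg_right (Nat.cast_le.2 h₇) (hξ.1 n)
  · obtain ⟨N, hN⟩ := exists_ceil_sq_lt hε₀ hε₂
    -- The terms of order `n ^ 2` are at most `262 * n ^ 2 < n ^ 3 / 3`.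
    refine ⟨max N 1000, fun K _ _ n hn => ⟨_, isCharBound_sum_roundCost K n,
      fun F factB hF M r hr => ?_⟩⟩
    have hn₁ : (1000 : ℝ) ≤ n := by exact_mod_cast (le_max_right N 1000).trans hn
    have hq : 1 < Fintype.card K := Fintype.one_lt_card
    have hsq := hN n ((le_max_left N 1000).trans hn) _ hq
    obtain ⟨hm0, hm⟩ := le_mul_pow_ceil (by omega : 0 < n) hq hε₀ hε₂
    obtain ⟨-, -, -, -, h₅, hs, h₆, -⟩ := minPolyMC_spec F M ε hr
    set m : ℤ := ⌈(Real.logb 2 n - Real.logb 2 ε) / Real.logb 2 (Fintype.card K)⌉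
    have hum : (r.1.u : ℝ) ≤ m := by
      have : r.1.u ≤ m.toNat := (h₅.trans_le (min_le_left _ _)).trans (roundBound_le M hm)
      exact_mod_cast (Nat.cast_le.2 this).trans_eq (Int.toNat_of_nonneg hm0)
    have hsum := sum_ordCost_le
      (fun i hi => hs i (hi.trans (h₅.trans_le (min_le_right _ _)))) hum
    have hchar := sum_roundCost_le n
    have hn₂ : (0 : ℝ) < (n : ℝ) ^ 2 := by positivity
    refine ⟨h₆ _ _ (isCharBound_sum_roundCost K n) hF, ?_, ?_⟩
    · nlinarith
    · nlinarith
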